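/- Let $\mathbb N=\{1,2,\dots\}$ and let $b=(b_k)_{k\ge1}$, $\omega=(\omega_k)_{k\ge1}$ be real sequences satisfying (A1) $\sum_k b_k^2<\infty$ and $b_k\ne0$ for all $k$; (A2) $\omega_1>0$ and there is $\omega_*>0$ with $\omega_{k+1}-\omega_k\ge\omega_*$ for all $k$; (A4) $\displaystyle\sum_{k\ge1}\sum_{j\ne k}\frac{b_j^2}{(\omega_j-\omega_k)^2}<\infty$; (A5) for a given $\rho>0$, $\displaystyle\sum_{k\ge1}\frac1{|b_k|^{2\rho}}\sum_{j\ne k}\frac{|b_j|^{2(1+\rho)}}{(\omega_j-\omega_k)^2}<\infty$. Let $X=\ell^2(\mathbb C)^4$, with elements written $\theta=(z,\zeta,p,q)$, and for $\gamma\in\mathbb R$ let $V^X_{0,\gamma}$ be the Hilbert space of all quadruples $\theta=(z,\zeta,p,q)$ of complex sequences with $$\|\theta\|_{V^X_{0,\gamma}}^2=\sum_{k\ge1}\frac{|z_k|^2+|\zeta_k|^2+|p_k|^2+|q_k|^2}{|b_k|^{2\gamma}}<\infty .$$ Let $\mathcal A$ be the operator on $X$ with domain $D(\mathcal A)=\{\theta\in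 X:\sum_k\omega_k^2(|z_k|^2+|\zeta_k|^2+|p_k|^2+|q_k|^2)<\infty\}$ that maps $(z,\zeta,p,q)$ to the element of $X$ with coordinates $$-i\omega_kz_k+b_k\phi,\quad i\omega_k\zeta_k-b_k\phi,\quad z_k-i\omega_kp_k,\quad \zeta_k+i\omega_kq_k,\qquad \phi=\tfrac12\sum_jb_j(p_j-q_j).$$ Let $(\nu_k)_{k\ge1}$ be complex numbers that label eigenvalues of $\mathcal A$ in the following sense: the numbers $$\sigma_k^+=i\omega_k+\nu_k,\quad \sigma_k^-=i\omega_k-\overline{\nu_k},\quad \sigma_{-k}^+=-i\omega_k+\overline{\nu_k},\quad \sigma_{-k}^-=-i\omega_k-\nu_k\qquad(k\ge1)$$ are eigenvalues of $\mathcal A$, no number occurs twice in this list, and for all sufficiently large $k$ $$|\nu_k-\lambda_k^0|<\frac{\lambda_k^0}2,\qquad \lambda^0_k=\frac{|b_k|}{\sqrt{2+\frac{b_k^2}{4\omega_k^2}+2\sum_{j\ne k}\frac{b_j^2(\omega_k^2+\omega_j^2)}{(\omega_k^2-\omega_j^2)^2}}} .$$ For $\sigma\notin\{\pm i\omega_j\}$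 let $\theta(\sigma)\in X$ have the coordinates $$\frac{b_j}{\sigma+i\omega_j},\quad -\frac{b_j}{\sigma-i\omega_j},\quad \frac{b_j}{(\sigma+i\omega_j)^2},\quad -\frac{b_j}{(\sigma-i\omega_j)^2},$$ put $\theta_{k}^\pm=\theta(\sigma_k^\pm)$, $\theta_{-k}^\pm=\theta(\sigma_{-k}^\pm)$, and $$\theta_k^z=\frac{\overline{\nu_k}^2\theta_{-k}^+-\nu_k^2\theta_{-k}^-}{2b_k\operatorname{Re}\nu_k},\quad \theta_k^\zeta=-\frac{\nu_k^2\theta_k^+-\overline{\nu_k}^2\theta_k^-}{2b_k\operatorname{Re}\nu_k},\quad \theta_k^p=\frac{\overline{\nu_k}^2\theta_{-k}^++\nu_k^2\theta_{-k}^-}{2b_k},\quad \theta_k^q=-\frac{\nu_k^2\theta_k^++\overline{\nu_k}^2\theta_k^-}{2b_k}.$$ Then the synthesis operator $$\pi_0a=\sum_{k\ge1}\bigl(a_k^z\theta_k^z+a_k^\zeta\theta_k^\zeta+a_k^p\theta_k^p+a_k^q\theta_k^q\bigr),\qquad a=(a^z,a^\zeta,a^p,a^q)\in X,$$ where the series converges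 unconditionally in $X$, is a bounded bijection of $X$ onto $X$ with bounded inverse, $X\subset V^X_{0,-\rho}$, and $\pi_0$ extends to a bounded linear bijection of $V^X_{0,-\rho}$ onto itself with bounded inverse. -/

import Mathlib

open scoped ENNReal

noncomputable section

/-- Parameters of the oscillating system, with the two standing assumptions:
`b` is a square-summable real sequence without zero entries, and the frequencies `ω` are positive
with a uniform gap. The positive integers of the text are numbered from `0` here. -/
structure Oscillator where
  b : ℕ → ℝ
  ω : ℕ → ℝ
  summable_sq : Summable fun k => b k ^ 2
  b_ne_zero : ∀ k, b k ≠ 0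
  ω_pos : 0 < ω 0
  gap : ∃ ωs : ℝ, 0 < ωs ∧ ∀ k, ωs ≤ ω (k + 1) - ω k

/-- The Hilbert space `X = ℓ²(ℂ)⁴`, written as the space of square-summable sequences in `ℂ⁴`. For
`θ = (z, ζ, p, q)` the entries `θ k 0`, `θ k 1`, `θ k 2`, `θ k 3` are `z_k`, `ζ_k`, `p_k`, `q_k`. -/
abbrev StateSpace : Type := lp (fun _ : ℕ => EuclideanSpace ℂ (Fin 4)) 2

namespace Oscillator

variable (P : Oscillator)

/-- Assumption (A4). -/
def A4 : Prop :=
  Summable fun x : ℕ × ℕ =>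
    if x.2 = x.1 then 0 else P.b x.2 ^ 2 / (P.ω x.2 - P.ω x.1) ^ 2

/-- Assumption (A5) for the exponent `ρ`. -/
def A5 (ρ : ℝ) : Prop :=
  Summable fun x : ℕ × ℕ =>
    if x.2 = x.1 then 0
    else 1 / |P.b x.1| ^ (2 * ρ) * (|P.b x.2| ^ (2 * (1 + ρ)) / (P.ω x.2 - P.ω x.1) ^ 2)

/-! ### The weighted spaces -/

/-- The sequences `v = (z, ζ, p, q)` in `ℂ⁴` such that `v_k / |b_k| ^ γ` is square-summable. -/
def weightedSubmodule (γ : ℝ) : Submodule ℂ (ℕ → EuclideanSpace ℂ (Fin 4)) where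
  carrier := {v | Memℓp (fun k => ((|P.b k| ^ (-γ) : ℝ) : ℂ) • v k) 2}
  zero_mem' := by
    have h : Memℓp (0 : (k : ℕ) → EuclideanSpace ℂ (Fin 4)) 2 := zero_memℓp
    simpa [Pi.zero_def] using h
  add_mem' := by
    intro v w hv hw
    have h := Memℓp.add hv hw
    simpa [Pi.add_def, smul_add] using h
  smul_mem' := by
    intro c v hv
    have h := Memℓp.const_smul hv c
    simpa [Pi.smul_def, smul_comm c] using h

/-- The weighted space `V_{0,γ}^X`: all sequences of finite weighted norm, see `norm_sq`. -/
def WeightedSpace (γ : ℝ) : Type := P.weightedSubmodule γ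

namespace WeightedSpace

variable {P} {γ : ℝ}

instance : AddCommGroup (P.WeightedSpace γ) := inferInstanceAs (AddCommGroup (P.weightedSubmodule γ))

instance : Module ℂ (P.WeightedSpace γ) := inferInstanceAs (Module ℂ (P.weightedSubmodule γ))

/-- The underlying sequence in `ℂ⁴`. -/
def val (v : P.WeightedSpace γ) : ℕ → EuclideanSpace ℂ (Fin 4) := v.1

theorem memlp (v : P.WeightedSpace γ) :
    Memℓp (fun k => ((|P.b k| ^ (-γ) : ℝ) : ℂ) • v.val k) 2 := v.2

/-- The diagonal map `W_γ`, dividing the `k`-th entry by `|b_k| ^ γ`. -/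
def W : P.WeightedSpace γ →ₗ[ℂ] StateSpace where
  toFun v := ⟨fun k => ((|P.b k| ^ (-γ) : ℝ) : ℂ) • v.val k, v.memlp⟩
  map_add' v w := by
    ext k : 2
    exact smul_add _ (v.val k) (w.val k)
  map_smul' c v := by
    ext k : 2
    exact smul_comm _ c (v.val k)

theorem W_apply (v : P.WeightedSpace γ) (k : ℕ) :
    W v k = ((|P.b k| ^ (-γ) : ℝ) : ℂ) • v.val k := rfl

theorem W_injective : Function.Injective (W : P.WeightedSpace γ →ₗ[ℂ] StateSpace) := by
  intro v w h
  apply Subtype.ext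
  funext k
  have hk : W v k = W w k := by rw [h]
  rw [W_apply, W_apply] at hk
  have hne : ((|P.b k| ^ (-γ) : ℝ) : ℂ) ≠ 0 := by
    exact_mod_cast (Real.rpow_pos_of_pos (abs_pos.mpr (P.b_ne_zero k)) _).ne'
  exact smul_right_injective _ hne hk

instance : NormedAddCommGroup (P.WeightedSpace γ) :=
  NormedAddCommGroup.induced _ _ (W : P.WeightedSpace γ →ₗ[ℂ] StateSpace) W_injective

instance : NormedSpace ℂ (P.WeightedSpace γ) :=
  NormedSpace.induced ℂ _ _ (W : P.WeightedSpace γ →ₗ[ℂ] StateSpace)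

theorem norm_sq (v : P.WeightedSpace γ) :
    ‖v‖ ^ 2 = ∑' k, (‖v.val k 0‖ ^ 2 + ‖v.val k 1‖ ^ 2 + ‖v.val k 2‖ ^ 2 + ‖v.val k 3‖ ^ 2)
      / |P.b k| ^ (2 * γ) := by
  have h0 : ‖v‖ = ‖W v‖ := rfl
  have h := lp.norm_rpow_eq_tsum (p := 2) (by norm_num) (W v)
  simp only [ENNReal.toReal_ofNat, Real.rpow_two] at h
  rw [h0, h]
  refine tsum_congr fun k => ?_
  have hb : 0 < |P.b k| := abs_pos.mpr (P.b_ne_zero k)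
  have hr : (|P.b k| ^ (-γ)) ^ 2 = (|P.b k| ^ (2 * γ))⁻¹ := by
    rw [← Real.rpow_natCast, ← Real.rpow_mul hb.le, ← Real.rpow_neg hb.le]
    congr 1
    push_cast
    ring
  rw [W_apply, norm_smul, mul_pow, Complex.norm_real, Real.norm_eq_abs,
    abs_of_pos (Real.rpow_pos_of_pos hb _), hr, EuclideanSpace.norm_sq_eq, Fin.sum_univ_four,
    div_eq_inv_mul]

end WeightedSpace

/-! ### The operator `𝒜` and its eigenvalues -/

/-- The functional `φ = ½ b^*(p - q)`. -/
def phi (θ : StateSpace) : ℂ := 1 / 2 * ∑' j, (P.b j : ℂ) * (θ j 2 - θ j 3)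

/-- The domain of `𝒜`. -/
def domA : Set StateSpace := {θ | Summable fun k => P.ω k ^ 2 * ‖θ k‖ ^ 2}

/-- The entries of `𝒜 θ`. -/
def calA (θ : StateSpace) (k : ℕ) : EuclideanSpace ℂ (Fin 4) :=
  !₂[-Complex.I * P.ω k * θ k 0 + P.b k * P.phi θ,
    Complex.I * P.ω k * θ k 1 - P.b k * P.phi θ,
    θ k 0 - Complex.I * P.ω k * θ k 2,
    θ k 1 + Complex.I * P.ω k * θ k 3]

/-- `σ` is an eigenvalue of `𝒜`. -/
def IsEigenvalue (σ : ℂ) : Prop :=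
  ∃ θ ∈ P.domA, θ ≠ 0 ∧ ∀ k, P.calA θ k = σ • θ k

/-- The leading term `λ_k⁰`. -/
def lam (k : ℕ) : ℝ :=
  |P.b k| / √(2 + P.b k ^ 2 / (4 * P.ω k ^ 2) +
    2 * ∑' j, if j = k then 0 else
      P.b j ^ 2 * (P.ω k ^ 2 + P.ω j ^ 2) / (P.ω k ^ 2 - P.ω j ^ 2) ^ 2)

/-- The four numbers `σ_k⁺`, `σ_k⁻`, `σ_{-k}⁺`, `σ_{-k}⁻` (in this order) determined by `ν_k`. -/
def sigma (ν : ℕ → ℂ) (k : ℕ) : Fin 4 → ℂ :=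
  ![Complex.I * P.ω k + ν k,
    Complex.I * P.ω k - (starRingEnd ℂ) (ν k),
    -Complex.I * P.ω k + (starRingEnd ℂ) (ν k),
    -Complex.I * P.ω k - ν k]

/-- `ν` labels eigenvalues of `𝒜`: all `σ_k^±`, `σ_{-k}^±` are eigenvalues, no eigenvalue is listed
twice, and `ν_k = λ_k⁰ + ε_k` with `|ε_k| < λ_k⁰ / 2` for all large `k`. -/
structure IsLabelling (ν : ℕ → ℂ) : Prop where
  eigenvalue : ∀ k i, P.IsEigenvalue (P.sigma ν k i)
  injective : Function.Injective fun x : ℕ × Fin 4 => P.sigma ν x.1 x.2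
  asymptotic : ∀ᶠ k in Filter.atTop, ‖ν k - P.lam k‖ < P.lam k / 2

/-! ### The eigenvectors and the Riesz basis -/

/-- The entries of `θ(σ)`. -/
def thetaSeq (σ : ℂ) (j : ℕ) : EuclideanSpace ℂ (Fin 4) :=
  !₂[P.b j / (σ + Complex.I * P.ω j),
    -(P.b j / (σ - Complex.I * P.ω j)),
    P.b j / (σ + Complex.I * P.ω j) ^ 2,
    -(P.b j / (σ - Complex.I * P.ω j) ^ 2)]

theorem tendsto_ω : Filter.Tendsto P.ω Filter.atTop Filter.atTop := by
  obtain ⟨ωs, hpos, hgap⟩ := P.gap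
  have h : ∀ k : ℕ, (k : ℝ) * ωs ≤ P.ω k := by
    intro k
    induction k with
    | zero => simpa using P.ω_pos.le
    | succ k ih =>
      have := hgap k
      push_cast
      linarith
  exact Filter.tendsto_atTop_mono h
    (tendsto_natCast_atTop_atTop.atTop_mul_const hpos)

theorem exists_bound_inv (σ s : ℂ) (hs : ‖s‖ = 1) :
    ∃ C : ℝ, ∀ j, ‖(σ + s * P.ω j)⁻¹‖ ≤ C := by
  have h1 : Filter.Tendsto (fun j => ‖σ + s * P.ω j‖) Filter.atTop Filter.atTop := by
    refine Filter.tendsto_atTop_mono (fun j => ?_)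
      (Filter.tendsto_atTop_add_const_right _ (-‖σ‖) P.tendsto_ω)
    have h2 := norm_sub_norm_le (s * (P.ω j : ℂ)) (-σ)
    rw [sub_neg_eq_add, norm_neg, norm_mul, hs, one_mul, Complex.norm_real, Real.norm_eq_abs,
      add_comm (s * (P.ω j : ℂ))] at h2
    linarith [le_abs_self (P.ω j)]
  have h2 := (h1.inv_tendsto_atTop).bddAbove_range
  obtain ⟨C, hC⟩ := h2
  refine ⟨C, fun j => ?_⟩
  rw [norm_inv]
  exact hC ⟨j, rfl⟩

theorem memlp_thetaSeq (σ : ℂ) : Memℓp (P.thetaSeq σ) 2 := by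
  obtain ⟨C, hC⟩ := P.exists_bound_inv σ Complex.I Complex.norm_I
  obtain ⟨D, hD⟩ := P.exists_bound_inv σ (-Complex.I) (by simp)
  rw [memℓp_gen_iff (by norm_num)]
  simp only [ENNReal.toReal_ofNat, Real.rpow_two]
  refine Summable.of_nonneg_of_le (fun j => by positivity) (fun j => ?_)
    (P.summable_sq.mul_left (C ^ 2 + D ^ 2 + (C ^ 2) ^ 2 + (D ^ 2) ^ 2))
  have hc := hC j
  have hd := hD j
  rw [neg_mul, ← sub_eq_add_neg] at hd
  have hc2 : ‖(σ + Complex.I * P.ω j)⁻¹‖ ^ 2 ≤ C ^ 2 := by gcongr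
  have hd2 : ‖(σ - Complex.I * P.ω j)⁻¹‖ ^ 2 ≤ D ^ 2 := by gcongr
  have hc4 : (‖(σ + Complex.I * P.ω j)⁻¹‖ ^ 2) ^ 2 ≤ (C ^ 2) ^ 2 := by gcongr
  have hd4 : (‖(σ - Complex.I * P.ω j)⁻¹‖ ^ 2) ^ 2 ≤ (D ^ 2) ^ 2 := by gcongr
  have key : ‖P.thetaSeq σ j‖ ^ 2 = (‖(σ + Complex.I * P.ω j)⁻¹‖ ^ 2
      + ‖(σ - Complex.I * P.ω j)⁻¹‖ ^ 2 + (‖(σ + Complex.I * P.ω j)⁻¹‖ ^ 2) ^ 2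
      + (‖(σ - Complex.I * P.ω j)⁻¹‖ ^ 2) ^ 2) * P.b j ^ 2 := by
    rw [EuclideanSpace.norm_sq_eq, Fin.sum_univ_four]
    simp [thetaSeq, div_eq_mul_inv, mul_pow]
    ring
  rw [key]
  gcongr

/-- The vector `θ(σ)` of `X`; it is an eigenvector when `σ` is an eigenvalue. -/
def theta (σ : ℂ) : StateSpace := ⟨P.thetaSeq σ, P.memlp_thetaSeq σ⟩

/-- The vectors `θ_k^z`, `θ_k^ζ`, `θ_k^p`, `θ_k^q` (in this order). -/
def rieszVector (ν : ℕ → ℂ) (k : ℕ) : Fin 4 → StateSpace :=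
  let c : ℂ := 1 / (2 * P.b k * (ν k).re)
  let d : ℂ := 1 / (2 * P.b k)
  let n : ℂ := ν k ^ 2
  let m : ℂ := (starRingEnd ℂ) (ν k) ^ 2
  ![c • (m • P.theta (P.sigma ν k 2) - n • P.theta (P.sigma ν k 3)),
    -(c • (n • P.theta (P.sigma ν k 0) - m • P.theta (P.sigma ν k 1))),
    d • (m • P.theta (P.sigma ν k 2) + n • P.theta (P.sigma ν k 3)),
    -(d • (n • P.theta (P.sigma ν k 0) + m • P.theta (P.sigma ν k 1)))]

/-- `π₀` is the synthesis operator: `π₀ a = ∑_k (a_k^z θ_k^z + a_k^ζ θ_k^ζ + a_k^p θ_k^p + a_k^q θ_k^q)`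
with convergence in `X`. -/
def IsSynthesis (ν : ℕ → ℂ) (π₀ : StateSpace ≃L[ℂ] StateSpace) : Prop :=
  ∀ a : StateSpace, HasSum (fun x : ℕ × Fin 4 => a x.1 x.2 • P.rieszVector ν x.1 x.2) (π₀ a)

end Oscillator

end

/-! The proof follows Bari's criterion. If a family is at square-summable distance from an
orthonormal basis, its synthesis operator is an invertible operator plus one of finite rank. It is
therefore bijective once it is injective or has dense range (`exists_synthesis_of_summable_sq_sub`).

Closeness: the weights in the Riesz vectors cancel the small denominators at index k. For large k
the entry at k is the unit vector up to O(|b_k|), and the entry at j ≠ k is O(|b_j| / |ω_j - ω_k|).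
These errors are square-summable by `summable_sq` and `A4`.

Injectivity: a vanishing combination is rewritten as ∑ c_n θ(s_n) = 0 over eigenvalues s_n.
Equivalently, F(z) = ∑ c_n / (z - s_n) and its derivative vanish at all ± i ω_j. With χ = `charSum`,
partial fractions give F(z) χ(z) = ∑ c_n χ(s_n) / (z - s_n) = 2 F(z), because eigenvalues solve χ =
2. Since χ ≠ 2 in a punctured neighbourhood of each s_m, F vanishes near s_m, and so does its
residue c_m (`eq_zero_of_hasSum`).

Weighted space: let D multiply the k-th entry by |b_k|^ρ. By `A5` the vectors |b_k|^(-ρ) D θ_k are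
again close to the unit vectors, and their synthesis operator S satisfies S D = D π₀. As D has dense
range and π₀ is onto, S has dense range, hence is bijective. The isometry of the weighted space onto
X extends D, so conjugating S by it extends π₀. -/

open Filter Topology

/-! ### Finite-rank perturbations of the identity -/

/-- A perturbation of the identity by an operator with values in a finite-dimensional space is
surjective as soon as it is injective. -/
theorem surjective_one_add_of_injective {𝕜 E : Type*} [Field 𝕜] [AddCommGroup E] [Module 𝕜 E]
    (R : E →ₗ[𝕜] E) (V : Submodule 𝕜 E) [FiniteDimensional 𝕜 V] (hR : ∀ x, R x ∈ V)
    (h : Function.Injective fun x => x + R x) : Function.Surjective fun x => x + R x := by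
  let g : V →ₗ[𝕜] V := (LinearMap.id + R).restrict (p := V) (q := V)
    fun x hx => V.add_mem hx (hR x)
  have hg : Function.Injective g := fun x y hxy => by
    have := congrArg Subtype.val hxy
    exact Subtype.ext (h this)
  have hs := LinearMap.injective_iff_surjective.1 hg
  -- With `v + R v = R y` solved inside `V`, the vector `y - v` is a preimage of `y`.
  intro y
  obtain ⟨v, hv⟩ := hs ⟨R y, hR y⟩
  have hv' : (v : E) + R v = R y := congrArg Subtype.val hv
  exact ⟨y - v, by simp only [map_sub]; rw [← hv']; abel⟩

/-- A perturbation of the identity by an operator with values in a finite-dimensional space is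
injective as soon as it is surjective. -/
theorem injective_one_add_of_surjective {𝕜 E : Type*} [Field 𝕜] [AddCommGroup E] [Module 𝕜 E]
    (R : E →ₗ[𝕜] E) (V : Submodule 𝕜 E) [FiniteDimensional 𝕜 V] (hR : ∀ x, R x ∈ V)
    (h : Function.Surjective fun x => x + R x) : Function.Injective fun x => x + R x := by
  let g : V →ₗ[𝕜] V := (LinearMap.id + R).restrict (p := V) (q := V)
    fun x hx => V.add_mem hx (hR x)
  have hg : Function.Surjective g := by
    rintro ⟨v, hv⟩
    obtain ⟨y, hy⟩ := h v
    have hy' : y + R y = v := hy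
    have hyV : y ∈ V := by
      rw [eq_sub_of_add_eq hy']
      exact V.sub_mem hv (hR y)
    exact ⟨⟨y, hyV⟩, Subtype.ext hy'⟩
  have hi := LinearMap.injective_iff_surjective.2 hg
  -- The kernel lies in `V`, because `x = -R x` there.
  have hker : ∀ x, x + R x = 0 → x = 0 := by
    intro x hx
    have hxV : x ∈ V := by
      rw [eq_neg_of_add_eq_zero_left hx]
      exact V.neg_mem (hR x)
    have : g ⟨x, hxV⟩ = g 0 := by
      rw [map_zero]
      exact Subtype.ext hx
    exact congrArg Subtype.val (hi this)
  intro x y hxy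
  have hxy' : x + R x = y + R y := hxy
  refine sub_eq_zero.1 (hker _ ?_)
  rw [map_sub, sub_add_sub_comm, hxy', sub_self]

/-- A perturbation of the identity by a bounded operator with values in a finite-dimensional space
is surjective as soon as its range is dense. -/
theorem surjective_one_add_of_denseRange {E : Type*} [NormedAddCommGroup E] [NormedSpace ℂ E]
    (R : E →L[ℂ] E) (V : Submodule ℂ E) [FiniteDimensional ℂ V] (hR : ∀ x, R x ∈ V)
    (h : DenseRange fun x => x + R x) : Function.Surjective fun x => x + R x := by
  let S : E →L[ℂ] E := ContinuousLinearMap.id ℂ E + R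
  let R' : E →ₗ[ℂ] V := (R : E →ₗ[ℂ] E).codRestrict V hR
  -- The range of `1 + R` contains the kernel of `R`, a closed subspace of finite codimension. A
  -- subspace lying above such a one is closed.
  have hK : IsClosed (LinearMap.ker R' : Set E) := by
    have : (LinearMap.ker R' : Set E) = R ⁻¹' {0} := by
      ext x
      simp [R', LinearMap.mem_ker]
    rw [this]
    exact isClosed_singleton.preimage R.continuous
  have hle : LinearMap.ker R' ≤ LinearMap.range (S : E →ₗ[ℂ] E) := by
    intro x hx
    have hx0 : R x = 0 := congrArg Subtype.val (LinearMap.mem_ker.1 hx)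
    exact ⟨x, by simp [S, hx0]⟩
  have : FiniteDimensional ℂ (E ⧸ LinearMap.ker R') :=
    LinearEquiv.finiteDimensional R'.quotKerEquivRange.symm
  have hcl : IsClosed (LinearMap.range (S : E →ₗ[ℂ] E) : Set E) :=
    Submodule.isClosed_mono_of_finiteDimensional_quotient hK hle
  intro y
  have hy : y ∈ closure (Set.range fun x => x + R x) := h y
  have : (Set.range fun x => x + R x) = (LinearMap.range (S : E →ₗ[ℂ] E) : Set E) := by
    ext z; simp [S]
  rw [this, hcl.closure_eq] at hy
  obtain ⟨x, hx⟩ := hy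
  exact ⟨x, by simpa [S] using hx⟩

/-! ### Families quadratically close to a basis -/

section Bari

variable {ι H : Type*} [NormedAddCommGroup H] [NormedSpace ℂ H] [CompleteSpace H]

/-- The synthesis operator of a square-summable family. -/
theorem exists_synthesis_of_summable_sq (u : ι → H →L[ℂ] ℂ)
    (hu : ∀ a, HasSum (fun n => ‖u n a‖ ^ 2) (‖a‖ ^ 2)) (r : ι → H)
    (hr : Summable fun n => ‖r n‖ ^ 2) :
    ∃ K : H →L[ℂ] H, (∀ a, HasSum (fun n => u n a • r n) (K a)) ∧
      ‖K‖ ≤ √(∑' n, ‖r n‖ ^ 2) := by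
  have key : ∀ a, (Summable fun n => ‖u n a‖ * ‖r n‖) ∧
      ∑' n, ‖u n a‖ * ‖r n‖ ≤ ‖a‖ * √(∑' n, ‖r n‖ ^ 2) := by
    intro a
    have h2 : Real.HolderConjugate 2 2 := Real.HolderConjugate.two_two
    have h1 := Real.summable_and_inner_le_Lp_mul_Lq_tsum_of_nonneg h2
      (f := fun n => ‖u n a‖) (g := fun n => ‖r n‖) (fun n => norm_nonneg _)
      (fun n => norm_nonneg _) (by simpa using (hu a).summable) (by simpa using hr)
    refine ⟨h1.1, h1.2.trans_eq ?_⟩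
    simp only [Real.rpow_two]
    rw [(hu a).tsum_eq, ← Real.sqrt_eq_rpow, ← Real.sqrt_eq_rpow, Real.sqrt_sq (norm_nonneg a)]
  have hs : ∀ a, Summable fun n => u n a • r n := fun a =>
    Summable.of_norm (by simpa only [norm_smul] using (key a).1)
  let K : H →ₗ[ℂ] H :=
    { toFun := fun a => ∑' n, u n a • r n
      map_add' := fun a b => by
        rw [← (hs a).tsum_add (hs b)]
        simp only [map_add, add_smul]
      map_smul' := fun c a => by
        rw [RingHom.id_apply, ← (hs a).tsum_const_smul c]
        simp only [map_smul, smul_eq_mul, mul_smul] }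
  have hK : ∀ a, ‖K a‖ ≤ √(∑' n, ‖r n‖ ^ 2) * ‖a‖ := by
    intro a
    have h1 : ‖K a‖ ≤ ∑' n, ‖u n a • r n‖ :=
      norm_tsum_le_tsum_norm (by simpa only [norm_smul] using (key a).1)
    simp only [norm_smul] at h1
    rw [mul_comm]
    exact h1.trans (key a).2
  exact ⟨K.mkContinuous _ hK, fun a => (hs a).hasSum,
    LinearMap.mkContinuous_norm_le _ (Real.sqrt_nonneg _) _⟩

/-- A family that is square-summably close to a basis has a bounded synthesis operator. This operator
is a Fredholm operator of index zero: it is bijective if it is injective or has dense range. -/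
theorem exists_synthesis_of_summable_sq_sub (u : ι → H →L[ℂ] ℂ)
    (hu : ∀ a, HasSum (fun n => ‖u n a‖ ^ 2) (‖a‖ ^ 2)) (e : ι → H)
    (he : ∀ a, HasSum (fun n => u n a • e n) a) (f : ι → H)
    (hf : Summable fun n => ‖f n - e n‖ ^ 2) :
    ∃ T : H →L[ℂ] H, (∀ a, HasSum (fun n => u n a • f n) (T a)) ∧
      (Function.Injective T ∨ DenseRange T → Function.Bijective T) := by
  classical
  obtain ⟨K, hK, -⟩ := exists_synthesis_of_summable_sq u hu _ hf
  refine ⟨1 + K, fun a => ?_, ?_⟩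
  · have := (he a).add (hK a)
    simpa [← smul_add] using this
  -- The deviations outside `s` give an operator `K₁` of norm below 1, so `1 + K₁` is invertible.
  -- The rest `K - K₁` has finite rank, and multiplying `1 + K` by the inverse `B` reduces to a
  -- finite-rank perturbation of the identity.
  obtain ⟨s, hs⟩ : ∃ s : Finset ι, ∑' n : {n // n ∉ s}, ‖f n - e n‖ ^ 2 < 1 :=
    ((tendsto_tsum_compl_atTop_zero fun n => ‖f n - e n‖ ^ 2).eventually_lt_const
      one_pos).exists
  let r : ι → H := fun n => if n ∈ s then 0 else f n - e n
  have hr2 : ∀ n, ‖r n‖ ^ 2 = Set.indicator {n | n ∉ s} (fun n => ‖f n - e n‖ ^ 2) n := by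
    intro n
    by_cases h : n ∈ s <;> simp [r, h]
  obtain ⟨K₁, hK₁, hK₁n⟩ := exists_synthesis_of_summable_sq u hu r (by
    simp only [hr2]; exact hf.indicator _)
  have hlt : ‖-K₁‖ < 1 := by
    rw [norm_neg]
    refine hK₁n.trans_lt ?_
    simp only [hr2]
    rw [← tsum_subtype, Real.sqrt_lt' one_pos, one_pow]
    exact hs
  let U : (H →L[ℂ] H)ˣ := Units.oneSub (-K₁) hlt
  have hU : (U : H →L[ℂ] H) = 1 + K₁ := by simp [U]
  let W : Submodule ℂ H := Submodule.span ℂ ((s.image fun n => f n - e n : Finset H) : Set H)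
  have hW : ∀ a, (K - K₁) a ∈ W := by
    intro a
    have h1 : HasSum (fun n => u n a • (f n - e n) - u n a • r n) ((K - K₁) a) :=
      (hK a).sub (hK₁ a)
    have h2 : HasSum (fun n => u n a • (f n - e n) - u n a • r n)
        (∑ n ∈ s, (u n a • (f n - e n) - u n a • r n)) := by
      refine hasSum_sum_of_ne_finset_zero fun n hn => ?_
      simp [r, hn]
    rw [h1.unique h2]
    refine W.sum_mem fun n hn => ?_
    simp only [r, hn, if_true, smul_zero, sub_zero]
    exact W.smul_mem _ (Submodule.subset_span (Finset.mem_coe.2 (Finset.mem_image_of_mem _ hn)))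
  let B : H →L[ℂ] H := (↑U⁻¹ : H →L[ℂ] H)
  have hBU : ∀ x, B (x + K₁ x) = x := by
    intro x
    have : (B * (U : H →L[ℂ] H)) x = x := by simp [B]
    simpa [hU] using this
  have hUB : ∀ x, B x + K₁ (B x) = x := by
    intro x
    have : ((U : H →L[ℂ] H) * B) x = x := by simp [B]
    simpa [hU] using this
  let R : H →L[ℂ] H := B * (K - K₁)
  let V : Submodule ℂ H := W.map (B : H →ₗ[ℂ] H)
  have : FiniteDimensional ℂ W := FiniteDimensional.span_finset ℂ _
  have hRV : ∀ x, R x ∈ V := fun x => Submodule.mem_map_of_mem (hW x)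
  have hBT : ∀ x, x + R x = B ((1 + K) x) := by
    intro x
    have : (1 + K) x = (x + K₁ x) + (K - K₁) x := by
      simp
    rw [this, map_add, hBU]
    rfl
  have hBij : Function.Bijective B :=
    ⟨fun x y h => by rw [← hUB x, ← hUB y, h], fun x => ⟨_, hBU x⟩⟩
  have hfun : (fun x => x + R x) = B ∘ (1 + K : H →L[ℂ] H) := funext hBT
  intro h
  have hbij : Function.Bijective fun x => x + R x := by
    rcases h with h | h
    · have hi : Function.Injective fun x => x + R x := by
        rw [hfun]; exact hBij.1.comp h
      exact ⟨hi, surjective_one_add_of_injective (R : H →ₗ[ℂ] H) V hRV hi⟩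
    · have hd : DenseRange fun x => x + R x := by
        rw [hfun]; exact hBij.2.denseRange.comp h B.continuous
      have hsj := surjective_one_add_of_denseRange R V hRV hd
      exact ⟨injective_one_add_of_surjective (R : H →ₗ[ℂ] H) V hRV hsj, hsj⟩
  rw [hfun] at hbij
  exact (Function.Bijective.of_comp_iff' hBij _).1 hbij

end Bari

/-! ### Series of simple fractions -/

section SimpleFractions

variable {ι : Type*} {s c : ι → ℂ}

/-- Points that tend to infinity stay away from a given point, in a quantitative sense. -/
theorem exists_one_add_norm_le (hs : Tendsto (fun n => ‖s n‖) cofinite atTop) (z : ℂ) :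
    ∃ C : ℝ, 0 < C ∧ ∀ n, s n ≠ z → 1 + ‖s n‖ ≤ C * ‖z - s n‖ := by
  -- The quotient is at most 4 for all but finitely many `n`. Where `s n = z` the division by zero
  -- gives 0, which does no harm.
  have hb : BddAbove (Set.range fun n => (1 + ‖s n‖) / ‖z - s n‖) := by
    refine IsBoundedUnder.bddAbove_range_of_cofinite ⟨4, ?_⟩
    rw [eventually_map]
    filter_upwards [hs.eventually_ge_atTop (2 * ‖z‖ + 1)] with n hn
    have h1 := norm_sub_norm_le (s n) z
    rw [norm_sub_rev] at h1
    have h0 := norm_nonneg z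
    rw [div_le_iff₀ (by linarith)]
    linarith
  obtain ⟨C, hC⟩ := hb
  refine ⟨max C 1, by positivity, fun n hn => ?_⟩
  have hpos : 0 < ‖z - s n‖ := norm_pos_iff.2 (sub_ne_zero.2 hn.symm)
  have h := hC ⟨n, rfl⟩
  rw [div_le_iff₀ hpos] at h
  exact h.trans (by gcongr; exact le_max_left _ _)

theorem summable_div_sub (hs : Tendsto (fun n => ‖s n‖) cofinite atTop)
    (hc : Summable fun n => ‖c n‖ / (1 + ‖s n‖)) {z : ℂ} (hz : ∀ n, s n ≠ z) :
    Summable fun n => ‖c n / (z - s n)‖ := by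
  obtain ⟨C, hC, h⟩ := exists_one_add_norm_le hs z
  refine Summable.of_nonneg_of_le (fun n => norm_nonneg _) (fun n => ?_) (hc.mul_left C)
  have hpos : 0 < ‖z - s n‖ := norm_pos_iff.2 (sub_ne_zero.2 (hz n).symm)
  have h1 : 0 < 1 + ‖s n‖ := by positivity
  rw [norm_div, div_le_iff₀ hpos, ← mul_div_assoc, div_mul_eq_mul_div, le_div_iff₀ h1]
  have := mul_le_mul_of_nonneg_left (h n (hz n)) (norm_nonneg (c n))
  linarith

theorem summable_div_sub_sq (hs : Tendsto (fun n => ‖s n‖) cofinite atTop)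
    (hc : Summable fun n => ‖c n‖ / (1 + ‖s n‖)) {z : ℂ} (hz : ∀ n, s n ≠ z) :
    Summable fun n => ‖c n / (z - s n) ^ 2‖ := by
  obtain ⟨C, hC, h⟩ := exists_one_add_norm_le hs z
  refine Summable.of_nonneg_of_le (fun n => norm_nonneg _) (fun n => ?_)
    ((summable_div_sub hs hc hz).mul_left C)
  have hpos : 0 < ‖z - s n‖ := norm_pos_iff.2 (sub_ne_zero.2 (hz n).symm)
  rw [norm_div, norm_div, norm_pow, sq, ← div_div, div_le_iff₀ hpos]
  have h1 : 1 ≤ C * ‖z - s n‖ := by linarith [h n (hz n), norm_nonneg (s n)]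
  have h2 : 0 ≤ ‖c n‖ / ‖z - s n‖ := by positivity
  nlinarith

/-- The residues of a series of simple fractions. -/
theorem tendsto_sub_mul_tsum_div_sub (hinj : Function.Injective s)
    (hs : Tendsto (fun n => ‖s n‖) cofinite atTop)
    (hc : Summable fun n => ‖c n‖ / (1 + ‖s n‖)) (m : ι) :
    Tendsto (fun z => (z - s m) * ∑' n, c n / (z - s n)) (𝓝[≠] s m) (𝓝 (c m)) := by
  classical
  obtain ⟨C, hC, h⟩ := exists_one_add_norm_le hs (s m)
  have hne : ∀ n, n ≠ m → s n ≠ s m := fun n hn h => hn (hinj h)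
  have hlim : Tendsto (fun z => ∑' n, (z - s m) * (c n / (z - s n))) (𝓝[≠] s m)
      (𝓝 (∑' n, if n = m then c m else 0)) := by
    -- In the majorant, `1 + ‖s m‖` serves the term `n = m` and `2 * C` the other terms.
    refine tendsto_tsum_of_dominated_convergence
      (bound := fun n => (1 + 2 * C) * (1 + ‖s m‖) * (‖c n‖ / (1 + ‖s n‖)))
      (hc.mul_left _) (fun n => ?_) ?_
    · by_cases hn : n = m
      · subst hn
        simp only [if_true]
        refine tendsto_const_nhds.congr' ?_
        filter_upwards [self_mem_nhdsWithin] with z hz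
        rw [mul_div_cancel₀]
        exact sub_ne_zero.2 hz
      · simp only [hn, if_false]
        have hc1 : ContinuousAt (fun z => (z - s m) * (c n / (z - s n))) (s m) := by
          refine ContinuousAt.mul (by fun_prop) (ContinuousAt.div (by fun_prop) (by fun_prop) ?_)
          exact sub_ne_zero.2 (hne n hn).symm
        have := hc1.tendsto.mono_left (nhdsWithin_le_nhds (s := {s m}ᶜ))
        simpa using this
    -- The radius `1 / (2 * C)` costs at most 1/2 in the separation estimate, which thus survives at
    -- `z` with `2 * C` in place of `C`. The radius 1 bounds the prefactor `z - s m`.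
    · have hball : Metric.ball (s m) (min 1 (1 / (2 * C))) ∈ 𝓝[≠] s m :=
        mem_nhdsWithin_of_mem_nhds (Metric.ball_mem_nhds _ (by positivity))
      filter_upwards [self_mem_nhdsWithin, hball] with z hz hzb n
      have hz0 : 0 < ‖z - s m‖ := norm_pos_iff.2 (sub_ne_zero.2 hz)
      rw [Metric.mem_ball, dist_eq_norm, lt_min_iff] at hzb
      have hnn : 0 < 1 + ‖s n‖ := by positivity
      have hcn := norm_nonneg (c n)
      rw [norm_mul, norm_div]
      by_cases hn : n = m
      · subst hn
        rw [mul_div_cancel₀ _ hz0.ne', mul_assoc, mul_div_cancel₀ _ hnn.ne']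
        nlinarith
      · have h1 := h n (hne n hn)
        have h2 : ‖s m - s n‖ ≤ ‖z - s m‖ + ‖z - s n‖ := by
          rw [norm_sub_rev z (s m)]
          exact norm_sub_le_norm_sub_add_norm_sub _ _ _
        have h3 : 1 + ‖s n‖ ≤ 2 * C * ‖z - s n‖ := by
          have h4 : C * ‖z - s m‖ ≤ 1 / 2 := by
            have := mul_le_mul_of_nonneg_left hzb.2.le hC.le
            have h5 : C * (1 / (2 * C)) = 1 / 2 := by field_simp
            linarith
          have h6 := mul_le_mul_of_nonneg_left h2 hC.le
          have := norm_nonneg (s n)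
          nlinarith
        have hpos : 0 < ‖z - s n‖ := by
          by_contra! h0
          have : 2 * C * ‖z - s n‖ ≤ 0 := mul_nonpos_of_nonneg_of_nonpos (by positivity) h0
          linarith
        have h7 : ‖c n‖ / ‖z - s n‖ ≤ 2 * C * (‖c n‖ / (1 + ‖s n‖)) := by
          rw [div_le_iff₀ hpos, ← mul_div_assoc, div_mul_eq_mul_div, le_div_iff₀ hnn]
          nlinarith
        have h8 : 0 ≤ ‖c n‖ / (1 + ‖s n‖) := by positivity
        have h9 : 0 ≤ 2 * C * (‖c n‖ / (1 + ‖s n‖)) := by positivity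
        have h10 : 0 ≤ ‖c n‖ / ‖z - s n‖ := by positivity
        have h11 := norm_nonneg (s m)
        calc ‖z - s m‖ * (‖c n‖ / ‖z - s n‖) ≤ 1 * (2 * C * (‖c n‖ / (1 + ‖s n‖))) := by
              gcongr
              exact hzb.1.le
          _ ≤ (1 + 2 * C) * (1 + ‖s m‖) * (‖c n‖ / (1 + ‖s n‖)) := by
              rw [one_mul]
              refine mul_le_mul_of_nonneg_right ?_ h8
              nlinarith [mul_nonneg hC.le h11]
  rw [tsum_ite_eq] at hlim
  simpa only [tsum_mul_left] using hlim

end SimpleFractions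

/-! ### The characteristic function -/

namespace Oscillator

variable (P : Oscillator)

/-- The complement of the spectrum `{± i ω_j}` of the uncoupled system. -/
def nonresonant : Set ℂ := {σ | ∀ j, σ + Complex.I * P.ω j ≠ 0 ∧ σ - Complex.I * P.ω j ≠ 0}

/-- The terms of the characteristic function. -/
noncomputable def charTerm (σ : ℂ) (j : ℕ) : ℂ :=
  (P.b j : ℂ) ^ 2 * (1 / (σ + Complex.I * P.ω j) ^ 2 + 1 / (σ - Complex.I * P.ω j) ^ 2)

/-- The characteristic function. The eigenvalues are the solutions of `charSum σ = 2`. -/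
noncomputable def charSum (σ : ℂ) : ℂ := ∑' j, P.charTerm σ j

theorem norm_charTerm_le {σ : ℂ} {j : ℕ} {δ : ℝ} (hδ : 0 < δ) (h1 : δ ≤ ‖σ + Complex.I * P.ω j‖)
    (h2 : δ ≤ ‖σ - Complex.I * P.ω j‖) : ‖P.charTerm σ j‖ ≤ 2 / δ ^ 2 * P.b j ^ 2 := by
  have h3 : ‖1 / (σ + Complex.I * P.ω j) ^ 2‖ ≤ 1 / δ ^ 2 := by
    rw [norm_div, norm_one, norm_pow]; gcongr
  have h4 : ‖1 / (σ - Complex.I * P.ω j) ^ 2‖ ≤ 1 / δ ^ 2 := by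
    rw [norm_div, norm_one, norm_pow]; gcongr
  rw [charTerm, norm_mul, norm_pow, Complex.norm_real, Real.norm_eq_abs, sq_abs, mul_comm]
  gcongr
  calc _ ≤ _ := norm_add_le _ _
    _ ≤ 1 / δ ^ 2 + 1 / δ ^ 2 := add_le_add h3 h4
    _ = 2 / δ ^ 2 := by ring

/-- The poles ± i ω_j escape to infinity, so they cannot accumulate at a point that avoids them all.
-/
theorem exists_dist_poles {σ : ℂ} (hσ : σ ∈ P.nonresonant) :
    ∃ δ : ℝ, 0 < δ ∧ ∀ j, δ ≤ ‖σ + Complex.I * P.ω j‖ ∧ δ ≤ ‖σ - Complex.I * P.ω j‖ := by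
  obtain ⟨C, hC⟩ := P.exists_bound_inv σ Complex.I Complex.norm_I
  obtain ⟨D, hD⟩ := P.exists_bound_inv σ (-Complex.I) (by simp)
  have hM : 0 < max (max C D) 1 := by positivity
  refine ⟨1 / max (max C D) 1, by positivity, fun j => ⟨?_, ?_⟩⟩
  · have h := (hC j).trans ((le_max_left C D).trans (le_max_left _ 1))
    rw [norm_inv] at h
    rw [one_div]
    exact inv_le_of_inv_le₀ (norm_pos_iff.2 (hσ j).1) h
  · have h := (hD j).trans ((le_max_right C D).trans (le_max_left _ 1))
    rw [neg_mul, ← sub_eq_add_neg, norm_inv] at h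
    rw [one_div]
    exact inv_le_of_inv_le₀ (norm_pos_iff.2 (hσ j).2) h

theorem summable_charTerm {σ : ℂ} (hσ : σ ∈ P.nonresonant) : Summable (P.charTerm σ) := by
  obtain ⟨δ, hδ, h⟩ := P.exists_dist_poles hσ
  exact Summable.of_norm_bounded (P.summable_sq.mul_left (2 / δ ^ 2))
    fun j => P.norm_charTerm_le hδ (h j).1 (h j).2

theorem analyticAt_charSum {σ : ℂ} (hσ : σ ∈ P.nonresonant) : AnalyticAt ℂ P.charSum σ := by
  obtain ⟨δ, hδ, h⟩ := P.exists_dist_poles hσ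
  have hb : ∀ z ∈ Metric.ball σ (δ / 2), ∀ j,
      δ / 2 ≤ ‖z + Complex.I * P.ω j‖ ∧ δ / 2 ≤ ‖z - Complex.I * P.ω j‖ := by
    intro z hz j
    rw [Metric.mem_ball, dist_comm, dist_eq_norm] at hz
    have h1 := norm_add_le (σ - z) (z + Complex.I * P.ω j)
    have h2 := norm_add_le (σ - z) (z - Complex.I * P.ω j)
    rw [← add_assoc, sub_add_cancel] at h1
    rw [sub_add_sub_cancel] at h2
    constructor <;> linarith [(h j).1, (h j).2]
  have hd : DifferentiableOn ℂ P.charSum (Metric.ball σ (δ / 2)) := by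
    refine Complex.differentiableOn_tsum_of_summable_norm
      (P.summable_sq.mul_left (2 / (δ / 2) ^ 2)) (fun j => ?_) Metric.isOpen_ball
      (fun j z hz => P.norm_charTerm_le (by positivity) (hb z hz j).1 (hb z hz j).2)
    intro z hz
    have h1 : (z + Complex.I * P.ω j) ^ 2 ≠ 0 := pow_ne_zero _ (norm_pos_iff.1
      ((half_pos hδ).trans_le (hb z hz j).1))
    have h2 : (z - Complex.I * P.ω j) ^ 2 ≠ 0 := pow_ne_zero _ (norm_pos_iff.1
      ((half_pos hδ).trans_le (hb z hz j).2))
    unfold charTerm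
    refine DifferentiableAt.differentiableWithinAt ?_
    fun_prop (disch := assumption)
  exact hd.analyticAt (Metric.ball_mem_nhds _ (by positivity))

/-- The solutions of the characteristic equation are isolated. -/
theorem eventually_charSum_ne {σ : ℂ} (hσ : σ ∈ P.nonresonant) :
    ∀ᶠ z in 𝓝[≠] σ, P.charSum z ≠ 2 := by
  rcases (P.analyticAt_charSum hσ).eventually_eq_or_eventually_ne
    (analyticAt_const (v := (2 : ℂ))) with h | h
  swap
  · exact h
  exfalso
  -- Removing countably many points leaves the plane connected, so a local identity χ = 2 would hold
  -- on all of `nonresonant`. It fails at `t = S + 1`, where |χ(t)| ≤ 2 S / t² < 2.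
  have hU : IsPreconnected P.nonresonant := by
    have hc : (Set.range (fun j => -(Complex.I * P.ω j)) ∪
        Set.range (fun j => Complex.I * P.ω j)).Countable :=
      (Set.countable_range _).union (Set.countable_range _)
    have h1 := (hc.isPathConnected_compl_of_one_lt_rank (E := ℂ)
      (by rw [Complex.rank_real_complex]; norm_num)).isConnected.isPreconnected
    convert h1 using 1
    ext z
    simp only [nonresonant, Set.mem_ofPred_eq, Set.mem_compl_iff, Set.mem_union, Set.mem_range,
      not_or, not_exists, ← forall_and]
    refine forall_congr' fun j => and_congr (not_congr ?_) (not_congr ?_)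
    · rw [add_eq_zero_iff_eq_neg, eq_comm]
    · rw [sub_eq_zero, eq_comm]
  have hEq := AnalyticOnNhd.eqOn_of_preconnected_of_eventuallyEq
    (fun z hz => P.analyticAt_charSum hz) (fun z _ => analyticAt_const (v := (2 : ℂ))) hU hσ h
  set S := ∑' j, P.b j ^ 2 with hS
  have hS0 : 0 ≤ S := tsum_nonneg fun j => sq_nonneg _
  set t : ℝ := S + 1 with ht
  have ht0 : 0 < t := by linarith
  have hd : ∀ j, t ≤ ‖(t : ℂ) + Complex.I * P.ω j‖ ∧ t ≤ ‖(t : ℂ) - Complex.I * P.ω j‖ := by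
    intro j
    have h1 := Complex.re_le_norm ((t : ℂ) + Complex.I * P.ω j)
    have h2 := Complex.re_le_norm ((t : ℂ) - Complex.I * P.ω j)
    simp at h1 h2
    exact ⟨h1, h2⟩
  have hmem : (t : ℂ) ∈ P.nonresonant := fun j =>
    ⟨norm_pos_iff.1 (ht0.trans_le (hd j).1), norm_pos_iff.1 (ht0.trans_le (hd j).2)⟩
  have h2 : P.charSum t = 2 := hEq hmem
  have hle : ‖P.charSum t‖ ≤ 2 / t ^ 2 * S := by
    rw [hS, ← tsum_mul_left]
    exact tsum_of_norm_bounded (P.summable_sq.mul_left _).hasSum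
      fun j => P.norm_charTerm_le ht0 (hd j).1 (hd j).2
  rw [h2, div_mul_eq_mul_div, le_div_iff₀ (by positivity)] at hle
  norm_num at hle
  nlinarith

/-- Eigenvalues are nonresonant solutions of the characteristic equation. -/
theorem IsEigenvalue.charSum_eq {σ : ℂ} (h : P.IsEigenvalue σ) :
    σ ∈ P.nonresonant ∧ P.charSum σ = 2 := by
  obtain ⟨θ, -, hθ, hev⟩ := h
  have e0 : ∀ j, (σ + Complex.I * P.ω j) * θ j 0 = P.b j * P.phi θ := fun j => by
    have := congrArg (fun v : EuclideanSpace ℂ (Fin 4) => v 0) (hev j)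
    simp [calA] at this
    linear_combination -this
  have e1 : ∀ j, (σ - Complex.I * P.ω j) * θ j 1 = -(P.b j * P.phi θ) := fun j => by
    have := congrArg (fun v : EuclideanSpace ℂ (Fin 4) => v 1) (hev j)
    simp [calA] at this
    linear_combination -this
  have e2 : ∀ j, (σ + Complex.I * P.ω j) * θ j 2 = θ j 0 := fun j => by
    have := congrArg (fun v : EuclideanSpace ℂ (Fin 4) => v 2) (hev j)
    simp [calA] at this
    linear_combination -this
  have e3 : ∀ j, (σ - Complex.I * P.ω j) * θ j 3 = θ j 1 := fun j => by
    have := congrArg (fun v : EuclideanSpace ℂ (Fin 4) => v 3) (hev j)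
    simp [calA] at this
    linear_combination -this
  have hb : ∀ j, (P.b j : ℂ) ≠ 0 := fun j => by exact_mod_cast P.b_ne_zero j
  have hωmono : StrictMono P.ω := by
    obtain ⟨ωs, hp, hg⟩ := P.gap
    exact strictMono_nat_of_lt_succ fun k => by linarith [hg k]
  have hωpos : ∀ j, 0 < P.ω j := fun j => P.ω_pos.trans_le (hωmono.monotone (Nat.zero_le j))
  -- If φ = 0, the z and ζ entries vanish. As the numbers ± i ω_k are distinct, σ equals at most one
  -- of them, so at most one entry of p and q survives. That entry alone would give φ = ± ½ b_k
  -- times itself, so it vanishes too.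
  have hφ : P.phi θ ≠ 0 := by
    intro hφ
    simp only [hφ, mul_zero, neg_zero, mul_eq_zero] at e0 e1
    have z0 : ∀ j, θ j 0 = 0 := fun j => by
      rcases e0 j with h | h
      · rw [← e2 j, h, zero_mul]
      · exact h
    have z1 : ∀ j, θ j 1 = 0 := fun j => by
      rcases e1 j with h | h
      · rw [← e3 j, h, zero_mul]
      · exact h
    simp only [z0, z1, mul_eq_zero] at e2 e3
    have hI : ∀ x : ℝ, Complex.I * x = 0 → x = 0 := fun x hx => by simpa using hx
    have z2 : ∀ j, θ j 2 = 0 := by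
      intro k
      by_contra hk
      have hσ := (e2 k).resolve_right hk
      have h2 : ∀ j, j ≠ k → θ j 2 = 0 := fun j hj => (e2 j).resolve_left fun h => hj <| by
        have := hI (P.ω j - P.ω k) (by push_cast; linear_combination h - hσ)
        exact hωmono.injective (sub_eq_zero.1 this)
      have h3 : ∀ j, θ j 3 = 0 := fun j => (e3 j).resolve_left fun h => by
        have := hI (P.ω j + P.ω k) (by push_cast; linear_combination hσ - h)
        linarith [hωpos j, hωpos k]
      rw [phi, tsum_eq_single k fun j hj => by rw [h2 j hj, h3 j]; simp, h3 k] at hφ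
      simp [hb k, hk] at hφ
    have z3 : ∀ j, θ j 3 = 0 := by
      intro k
      by_contra hk
      have hσ := (e3 k).resolve_right hk
      have h2 : ∀ j, j ≠ k → θ j 3 = 0 := fun j hj => (e3 j).resolve_left fun h => hj <| by
        have := hI (P.ω j - P.ω k) (by push_cast; linear_combination hσ - h)
        exact hωmono.injective (sub_eq_zero.1 this)
      rw [phi, tsum_eq_single k fun j hj => by rw [h2 j hj, z2 j]; simp, z2 k] at hφ
      simp [hb k, hk] at hφ
    apply hθ
    ext j i
    fin_cases i
    · exact z0 j
    · exact z1 j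
    · exact z2 j
    · exact z3 j
  have hmem : σ ∈ P.nonresonant := fun j => by
    constructor
    · intro h
      have := e0 j
      rw [h, zero_mul] at this
      exact mul_ne_zero (hb j) hφ this.symm
    · intro h
      have := e1 j
      rw [h, zero_mul] at this
      exact neg_ne_zero.2 (mul_ne_zero (hb j) hφ) this.symm
  refine ⟨hmem, ?_⟩
  have hterm : ∀ j, (P.b j : ℂ) * (θ j 2 - θ j 3) = P.phi θ * P.charTerm σ j := fun j => by
    obtain ⟨h1, h2⟩ := hmem j
    have f2 : θ j 2 = P.b j * P.phi θ / (σ + Complex.I * P.ω j) ^ 2 := by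
      rw [eq_div_iff (pow_ne_zero 2 h1), ← e0 j, ← e2 j]; ring
    have f3 : θ j 3 = -(P.b j * P.phi θ) / (σ - Complex.I * P.ω j) ^ 2 := by
      rw [eq_div_iff (pow_ne_zero 2 h2), ← e1 j, ← e3 j]; ring
    rw [f2, f3, charTerm]
    ring
  have hphi : P.phi θ = 1 / 2 * (P.phi θ * P.charSum σ) := by
    rw [charSum, ← tsum_mul_left, ← tsum_congr hterm]
    rfl
  have := mul_left_cancel₀ hφ (show P.phi θ * P.charSum σ = P.phi θ * 2 by
    linear_combination -2 * hphi)
  exact this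

/-! ### Simple fractions with poles at eigenvalues -/

/-- A series of simple fractions with poles at distinct eigenvalues that vanishes to second order at
the points `± i ω_j` is zero. -/
theorem eq_zero_of_hasSum {ι : Type*} {s c : ι → ℂ} (hinj : Function.Injective s)
    (hs : Tendsto (fun n => ‖s n‖) cofinite atTop)
    (hc : Summable fun n => ‖c n‖ / (1 + ‖s n‖))
    (hmem : ∀ n, s n ∈ P.nonresonant) (hchar : ∀ n, P.charSum (s n) = 2)
    (hbd : ∃ C : ℝ, ∀ n, (Summable fun j => ‖P.charTerm (s n) j‖) ∧
      ∑' j, ‖P.charTerm (s n) j‖ ≤ C)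
    (h0 : ∀ j, HasSum (fun n => c n / (s n + Complex.I * P.ω j)) 0)
    (h1 : ∀ j, HasSum (fun n => c n / (s n - Complex.I * P.ω j)) 0)
    (h2 : ∀ j, HasSum (fun n => c n / (s n + Complex.I * P.ω j) ^ 2) 0)
    (h3 : ∀ j, HasSum (fun n => c n / (s n - Complex.I * P.ω j) ^ 2) 0) : c = 0 := by
  obtain ⟨C, hbd⟩ := hbd
  have key : ∀ z ∈ P.nonresonant, (∀ n, s n ≠ z) → P.charSum z ≠ 2 →
      ∑' n, c n / (z - s n) = 0 := by
    intro z hz hne hz2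
    set F := ∑' n, c n / (z - s n) with hF
    have hsum := summable_div_sub hs hc hne
    have hFs : HasSum (fun n => c n / (z - s n)) F := hsum.of_norm.hasSum
    -- Partial fractions: 1/((z-s)(s-τ)²) = (1/(z-τ)²)(1/(z-s) + 1/(s-τ)) + (1/(z-τ)) · 1/(s-τ)².
    -- After summation over `n` only the term with 1/(z-s) remains.
    have hpf : ∀ τ : ℂ, z - τ ≠ 0 → (∀ n, s n - τ ≠ 0) →
        HasSum (fun n => c n / (s n - τ)) 0 → HasSum (fun n => c n / (s n - τ) ^ 2) 0 →
        HasSum (fun n => c n / (z - s n) * (1 / (s n - τ) ^ 2)) (F * (1 / (z - τ) ^ 2)) := by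
      intro τ hτ hτn ha hb
      have h := ((hFs.add ha).mul_left (1 / (z - τ) ^ 2)).add (hb.mul_left (1 / (z - τ)))
      rw [add_zero, mul_zero, add_zero, mul_comm _ F] at h
      convert! h using 2 with n
      have hx : z - s n ≠ 0 := sub_ne_zero.2 (hne n).symm
      have hy := hτn n
      field_simp
      ring
    have hcol : ∀ j, HasSum (fun n => c n / (z - s n) * P.charTerm (s n) j)
        (F * P.charTerm z j) := by
      intro j
      have ha := hpf (-(Complex.I * P.ω j)) (by simpa using (hz j).1)
        (fun n => by simpa using (hmem n j).1) (by simpa using h0 j) (by simpa using h2 j)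
      have hb := hpf (Complex.I * P.ω j) (hz j).2
        (fun n => (hmem n j).2) (h1 j) (h3 j)
      have h := (ha.add hb).mul_left ((P.b j : ℂ) ^ 2)
      simp only [sub_neg_eq_add] at h
      rw [← mul_add, mul_left_comm] at h
      convert! h using 2 with n
      rw [charTerm]
      ring
    -- The uniform bound `C` permits exchanging the sums. Summing over `n` first gives `F *
    -- P.charSum z`, over `j` first `F * 2`.
    have hdbl : Summable (Function.uncurry fun n j => c n / (z - s n) * P.charTerm (s n) j) := by
      refine Summable.of_norm ((summable_prod_of_nonneg fun _ => norm_nonneg _).2 ⟨fun n => ?_, ?_⟩)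
      · simp only [Function.uncurry_apply_pair, norm_mul]
        exact (hbd n).1.mul_left _
      · simp only [Function.uncurry_apply_pair, norm_mul, tsum_mul_left]
        refine Summable.of_nonneg_of_le (fun n => mul_nonneg (norm_nonneg _)
          (tsum_nonneg fun j => norm_nonneg _)) (fun n => ?_) (hsum.mul_right C)
        exact mul_le_mul_of_nonneg_left (hbd n).2 (norm_nonneg _)
    have hcomm := hdbl.tsum_comm
    simp only [tsum_mul_left, fun j => (hcol j).tsum_eq] at hcomm
    have hl : ∀ n, ∑' j, P.charTerm (s n) j = 2 := hchar
    simp only [hl, tsum_mul_right] at hcomm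
    change F * P.charSum z = F * 2 at hcomm
    by_contra hF0
    exact hz2 (mul_left_cancel₀ hF0 hcomm)
  funext m
  have hlim := tendsto_sub_mul_tsum_div_sub hinj hs hc m
  have hopen : ∀ᶠ z in 𝓝[≠] s m, z ∈ P.nonresonant := by
    obtain ⟨δ, hδ, h⟩ := P.exists_dist_poles (hmem m)
    filter_upwards [mem_nhdsWithin_of_mem_nhds (Metric.ball_mem_nhds (s m) hδ)] with z hz j
    rw [Metric.mem_ball, dist_comm, dist_eq_norm] at hz
    constructor
    · intro h4
      rw [eq_neg_of_add_eq_zero_left h4, sub_neg_eq_add] at hz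
      exact absurd (h j).1 (not_le.2 hz)
    · intro h4
      rw [sub_eq_zero.1 h4] at hz
      exact absurd (h j).2 (not_le.2 hz)
  have hnot : ∀ᶠ z in 𝓝[≠] s m, ∀ n, s n ≠ z := by
    obtain ⟨D, hD, h⟩ := exists_one_add_norm_le hs (s m)
    filter_upwards [self_mem_nhdsWithin, mem_nhdsWithin_of_mem_nhds
      (Metric.ball_mem_nhds (s m) (one_div_pos.2 hD))] with z hz hzb n hn
    rw [Metric.mem_ball, dist_comm, dist_eq_norm, lt_div_iff₀ hD] at hzb
    have hnm : s n ≠ s m := by rw [hn]; exact hz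
    have := h n hnm
    rw [hn] at this
    linarith [norm_nonneg z]
  have hzero : Tendsto (fun z => (z - s m) * ∑' n, c n / (z - s n)) (𝓝[≠] s m) (𝓝 0) := by
    refine tendsto_const_nhds.congr' ?_
    filter_upwards [hopen, hnot, P.eventually_charSum_ne (hmem m)] with z hz1 hz2 hz3
    rw [key z hz1 hz2 hz3, mul_zero]
  exact tendsto_nhds_unique hlim hzero

end Oscillator

/-! ### Location of the labelled eigenvalues -/

theorem eventually_cofinite_fst {β : Type*} [Finite β] {p : ℕ → Prop} (h : ∀ᶠ k in atTop, p k) :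
    ∀ᶠ x : ℕ × β in cofinite, p x.1 := by
  rw [← Nat.cofinite_eq_atTop, eventually_cofinite] at h
  rw [eventually_cofinite]
  exact (h.prod (Set.finite_univ (α := β))).subset fun x hx => ⟨hx, Set.mem_univ _⟩

theorem summable_prod_of_eventually_norm_le {β E : Type*} [Finite β] [NormedAddCommGroup E]
    [CompleteSpace E] {f : ℕ × β → E} {g : ℕ → ℝ} (hg : Summable g)
    (h : ∀ᶠ k in atTop, ∀ i, ‖f (k, i)‖ ≤ g k) : Summable f := by
  have := Fintype.ofFinite β
  have h1 : Summable fun x : ℕ × β => |g x.1| * 1 :=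
    hg.abs.mul_of_nonneg (summable_of_hasFiniteSupport (Set.toFinite _) : Summable fun _ : β => (1 : ℝ))
      (fun _ => abs_nonneg _) (fun _ => zero_le_one)
  refine Summable.of_norm_bounded_eventually h1 ?_
  filter_upwards [eventually_cofinite_fst h] with x hx
  rw [mul_one]
  exact (hx x.2).trans (le_abs_self _)

namespace Oscillator

variable (P : Oscillator)

theorem strictMono_ω : StrictMono P.ω := by
  obtain ⟨ωs, hp, hg⟩ := P.gap
  exact strictMono_nat_of_lt_succ fun k => by linarith [hg k]

theorem ω_zero_le (k : ℕ) : P.ω 0 ≤ P.ω k := P.strictMono_ω.monotone (Nat.zero_le k)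

theorem exists_gap : ∃ ωs : ℝ, 0 < ωs ∧ (∀ j k, j ≠ k → ωs ≤ |P.ω j - P.ω k|) ∧
    ∀ k : ℕ, k * ωs ≤ P.ω k := by
  obtain ⟨ωs, hp, hg⟩ := P.gap
  refine ⟨ωs, hp, ?_, fun k => ?_⟩
  · have key : ∀ j k, j < k → ωs ≤ P.ω k - P.ω j := fun j k h => by
      have := P.strictMono_ω.monotone (Nat.succ_le_of_lt h)
      have := hg j
      simp only [Nat.succ_eq_add_one] at *
      linarith
    intro j k hjk
    rcases lt_or_gt_of_ne hjk with h | h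
    · rw [abs_sub_comm]
      exact (key j k h).trans (le_abs_self _)
    · exact (key k j h).trans (le_abs_self _)
  · induction k with
    | zero => simpa using P.ω_pos.le
    | succ k ih =>
      have := hg k
      push_cast
      linarith

/-- Imaginary parts suffice: that of `sigma ν k i` is ± (ω_k + Im ν_k), and the shift uses up at
most half of the gap. -/
theorem dist_sigma {ν : ℕ → ℂ} {j k : ℕ} (h : ‖ν k‖ ≤ |P.ω j - P.ω k| / 2) (i : Fin 4) :
    |P.ω j - P.ω k| / 2 ≤ ‖P.sigma ν k i + Complex.I * P.ω j‖ ∧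
      |P.ω j - P.ω k| / 2 ≤ ‖P.sigma ν k i - Complex.I * P.ω j‖ := by
  have h0 := (Complex.abs_im_le_norm (ν k)).trans h
  have hj := P.ω_pos.trans_le (P.ω_zero_le j)
  have hk := P.ω_pos.trans_le (P.ω_zero_le k)
  refine ⟨le_trans ?_ (Complex.abs_im_le_norm _), le_trans ?_ (Complex.abs_im_le_norm _)⟩ <;>
  · fin_cases i <;> simp [sigma] <;> rcases abs_cases (P.ω j - P.ω k) with h1 | h1 <;>
      rw [h1.1] at h0 ⊢ <;> rw [abs_le] at h0 <;> rw [le_abs] <;>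
      first
        | (left; linarith)
        | (right; linarith)

/-- These are the denominators at index k that stay large: their imaginary parts are ± (2 ω_k + Im
ν_k). -/
theorem dist_sigma_self {ν : ℕ → ℂ} {k : ℕ} (h : ‖ν k‖ ≤ P.ω 0) :
    P.ω 0 ≤ ‖P.sigma ν k 0 + Complex.I * P.ω k‖ ∧ P.ω 0 ≤ ‖P.sigma ν k 1 + Complex.I * P.ω k‖ ∧
    P.ω 0 ≤ ‖P.sigma ν k 2 - Complex.I * P.ω k‖ ∧ P.ω 0 ≤ ‖P.sigma ν k 3 - Complex.I * P.ω k‖ := by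
  have h0 := abs_le.1 ((Complex.abs_im_le_norm (ν k)).trans h)
  have hk := P.ω_zero_le k
  refine ⟨?_, ?_, ?_, ?_⟩ <;> refine le_trans ?_ (Complex.abs_im_le_norm _) <;>
    simp [sigma] <;> rw [le_abs] <;>
      first
        | (left; linarith)
        | (right; linarith)

theorem le_norm_sigma (ν : ℕ → ℂ) (k : ℕ) (i : Fin 4) : P.ω k - ‖ν k‖ ≤ ‖P.sigma ν k i‖ := by
  have h0 := abs_le.1 (Complex.abs_im_le_norm (ν k))
  refine le_trans ?_ (Complex.abs_im_le_norm _)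
  rw [le_abs]
  fin_cases i <;> simp [sigma] <;>
    first
      | (left; linarith)
      | (right; linarith)

theorem lam_le (k : ℕ) : P.lam k ≤ |P.b k| := by
  refine div_le_self (abs_nonneg _) (Real.one_le_sqrt.2 ?_)
  have h1 : 0 ≤ ∑' j, if j = k then 0 else
      P.b j ^ 2 * (P.ω k ^ 2 + P.ω j ^ 2) / (P.ω k ^ 2 - P.ω j ^ 2) ^ 2 :=
    tsum_nonneg fun j => by split_ifs <;> positivity
  have h2 : 0 ≤ P.b k ^ 2 / (4 * P.ω k ^ 2) := by positivity
  linarith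

theorem tendsto_abs_b : Tendsto (fun k => |P.b k|) atTop (𝓝 0) := by
  have h := P.summable_sq.tendsto_atTop_zero.sqrt
  simpa [Real.sqrt_sq_eq_abs] using h

namespace IsLabelling

variable {P} {ν : ℕ → ℂ} (hν : P.IsLabelling ν)
include hν

/-- With λ = `lam k`, the asymptotics give Re ν ≥ λ/2 and ‖ν‖ ≤ 3λ/2. Hence ‖ν‖² ≤ (9/4) λ² ≤ (9/2)
|b| Re ν, as λ ≤ |b|. This last bound controls the coefficients that have Re ν in the denominator.
-/
theorem eventually_bounds {δ : ℝ} (hδ : 0 < δ) : ∀ᶠ k in atTop, 0 < (ν k).re ∧ ‖ν k‖ ≤ δ ∧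
    ‖ν k‖ ≤ 2 * |P.b k| ∧ ‖ν k‖ ^ 2 ≤ 5 * (|P.b k| * (ν k).re) := by
  filter_upwards [hν.asymptotic, P.tendsto_abs_b.eventually_le_const (half_pos hδ)] with k hk hb
  have hl := P.lam_le k
  have h1 := abs_le.1 ((Complex.abs_re_le_norm _).trans hk.le)
  rw [Complex.sub_re, Complex.ofReal_re] at h1
  have h2 := norm_sub_norm_le (ν k) (P.lam k)
  have h3 := (norm_nonneg _).trans_lt hk
  rw [Complex.norm_real, Real.norm_eq_abs, abs_of_pos (by linarith)] at h2
  have h4 : ‖ν k‖ ≤ 3 / 2 * P.lam k := by linarith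
  have h5 : 0 < (ν k).re := by linarith
  refine ⟨h5, by linarith, by linarith, ?_⟩
  have h6 : ‖ν k‖ ^ 2 ≤ (3 / 2 * P.lam k) ^ 2 := by gcongr
  have h7 : P.lam k * P.lam k ≤ |P.b k| * (2 * (ν k).re) := by
    gcongr <;> linarith only [h1.1, h3]
  have h8 : 0 ≤ |P.b k| * (ν k).re := by positivity
  nlinarith

/-- Otherwise σ_k⁺ and σ_k⁻ would coincide. -/
theorem re_ne_zero (k : ℕ) : (ν k).re ≠ 0 := by
  intro h
  have h1 : P.sigma ν k 0 = P.sigma ν k 1 := by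
    apply Complex.ext <;> simp [sigma, h]
  have h2 : ((k, 0) : ℕ × Fin 4) = (k, 1) := hν.injective h1
  simp at h2

theorem tendsto_norm_sigma :
    Tendsto (fun x : ℕ × Fin 4 => ‖P.sigma ν x.1 x.2‖) cofinite atTop := by
  refine tendsto_atTop.2 fun C => ?_
  have h : ∀ᶠ k in atTop, ∀ i, C ≤ ‖P.sigma ν k i‖ := by
    filter_upwards [hν.eventually_bounds one_pos, P.tendsto_ω.eventually_ge_atTop (C + 1)]
      with k hk hω i
    linarith [P.le_norm_sigma ν k i, hk.2.1]
  filter_upwards [eventually_cofinite_fst h] with x hx using hx x.2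

theorem eventually_dist : ∀ᶠ k in atTop, ∀ i j, j ≠ k →
    0 < |P.ω j - P.ω k| / 2 ∧ |P.ω j - P.ω k| / 2 ≤ ‖P.sigma ν k i + Complex.I * P.ω j‖ ∧
      |P.ω j - P.ω k| / 2 ≤ ‖P.sigma ν k i - Complex.I * P.ω j‖ := by
  obtain ⟨ωs, hpos, hgap, -⟩ := P.exists_gap
  filter_upwards [hν.eventually_bounds (half_pos hpos)] with k hk i j hj
  have h := hgap j k hj
  exact ⟨by linarith, P.dist_sigma (by linarith [hk.2.1]) i⟩

/-- For large k the terms j ≠ k are bounded through `A4`, with 8 = 2 / (1/2)² because the distances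
are at least half a gap. The term j = k has a small denominator; the characteristic equation
expresses it as 2 minus the other terms. -/
theorem exists_tsum_charTerm_le (hA4 : P.A4) : ∃ C : ℝ, ∀ x : ℕ × Fin 4,
    (Summable fun j => ‖P.charTerm (P.sigma ν x.1 x.2) j‖) ∧
      ∑' j, ‖P.charTerm (P.sigma ν x.1 x.2) j‖ ≤ C := by
  have hsum : ∀ k i, Summable fun j => ‖P.charTerm (P.sigma ν k i) j‖ := fun k i =>
    (P.summable_charTerm (hν.eigenvalue k i).charSum_eq.1).norm
  set S := ∑' k, ∑' j, if j = k then 0 else P.b j ^ 2 / (P.ω j - P.ω k) ^ 2 with hS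
  have hnn : ∀ k j, 0 ≤ if j = k then 0 else P.b j ^ 2 / (P.ω j - P.ω k) ^ 2 := fun k j => by
    split_ifs <;> positivity
  have hev : ∀ᶠ k in atTop, ∀ i, ∑' j, ‖P.charTerm (P.sigma ν k i) j‖ ≤ 2 + 2 * (8 * S) := by
    filter_upwards [hν.eventually_dist] with k hk i
    set f := P.charTerm (P.sigma ν k i) with hf
    have hoff : ∑' j, (if j = k then 0 else ‖f j‖) ≤ 8 * S := by
      have hrow : Summable fun j => if j = k then 0 else P.b j ^ 2 / (P.ω j - P.ω k) ^ 2 :=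
        hA4.prod_factor k
      have hle : ∀ j, (if j = k then 0 else ‖f j‖)
          ≤ 8 * if j = k then 0 else P.b j ^ 2 / (P.ω j - P.ω k) ^ 2 := by
        intro j
        split_ifs with hj
        · simp
        · obtain ⟨h1, h2, h3⟩ := hk i j hj
          refine (P.norm_charTerm_le h1 h2 h3).trans_eq ?_
          rw [div_pow, sq_abs]
          field_simp
          ring
      have hs : Summable fun j => if j = k then 0 else ‖f j‖ :=
        Summable.of_nonneg_of_le (fun j => by split_ifs <;> positivity) hle (hrow.mul_left 8)
      have h1 := hs.tsum_le_tsum hle (hrow.mul_left 8)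
      rw [tsum_mul_left] at h1
      have h2 := hA4.prod.le_tsum k fun l _ => tsum_nonneg fun j => hnn l j
      have h3 : ∑' j, (if j = k then 0 else P.b j ^ 2 / (P.ω j - P.ω k) ^ 2) ≤ S := h2
      linarith
    have hsk := (hsum k i).tsum_eq_add_tsum_ite k
    have hck : f k = 2 - ∑' j, if j = k then 0 else f j := by
      have h1 := (hsum k i).of_norm.tsum_eq_add_tsum_ite k
      have h2 : ∑' j, f j = 2 := (hν.eigenvalue k i).charSum_eq.2
      rw [← h2]
      exact eq_sub_of_add_eq h1.symm
    have hnorm : ∀ j, ‖if j = k then 0 else f j‖ = if j = k then 0 else ‖f j‖ := fun j => by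
      split_ifs <;> simp
    have hso : Summable fun j => ‖if j = k then 0 else f j‖ := by
      refine Summable.of_nonneg_of_le (fun j => norm_nonneg _) (fun j => ?_) (hsum k i)
      rw [hnorm]
      split_ifs
      · exact norm_nonneg _
      · exact le_rfl
    have hfk : ‖f k‖ ≤ 2 + 8 * S := by
      rw [hck]
      refine (norm_sub_le _ _).trans ?_
      have h1 := norm_tsum_le_tsum_norm hso
      simp only [hnorm] at h1
      have h2 : ‖(2 : ℂ)‖ = 2 := by simp
      linarith
    rw [hsk]
    linarith
  have hb : BddAbove (Set.range fun x : ℕ × Fin 4 =>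
      ∑' j, ‖P.charTerm (P.sigma ν x.1 x.2) j‖) := by
    refine IsBoundedUnder.bddAbove_range_of_cofinite ⟨2 + 2 * (8 * S), ?_⟩
    rw [eventually_map]
    filter_upwards [eventually_cofinite_fst hev] with x hx using hx x.2
  obtain ⟨C, hC⟩ := hb
  exact ⟨C, fun x => ⟨hsum _ _, hC ⟨x, rfl⟩⟩⟩

/-- The coefficients in front of the eigenvectors in the Riesz vectors are bounded. -/
theorem eventually_coeff_le : ∀ᶠ k in atTop, ∀ w : ℂ, ‖w‖ = ‖ν k‖ →
    ‖(1 / (2 * P.b k * (ν k).re) : ℂ) * w ^ 2‖ ≤ 5 / 2 ∧ ‖(1 / (2 * P.b k) : ℂ) * w ^ 2‖ ≤ 5 / 2 := by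
  filter_upwards [hν.eventually_bounds one_pos] with k hk w hw
  obtain ⟨h1, h2, -, h4⟩ := hk
  have hb : 0 < |P.b k| := abs_pos.2 (P.b_ne_zero k)
  have h5 : (ν k).re ≤ 1 := (Complex.re_le_norm _).trans h2
  simp only [norm_mul, norm_div, norm_one, norm_pow, hw, Complex.norm_real, Real.norm_eq_abs,
    Complex.norm_ofNat, abs_of_pos h1]
  constructor
  · rw [one_div_mul_eq_div, div_le_iff₀ (by positivity)]
    linarith
  · rw [one_div_mul_eq_div, div_le_iff₀ (by positivity)]
    nlinarith

end IsLabelling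

/-! ### From Riesz vectors to eigenvectors -/

/-- The coefficients of a combination of Riesz vectors with respect to the eigenvectors. -/
noncomputable def eigenCoeff (ν : ℕ → ℂ) (a : EuclideanSpace ℂ (Fin 4)) (k : ℕ) : Fin 4 → ℂ :=
  let c : ℂ := 1 / (2 * P.b k * (ν k).re)
  let d : ℂ := 1 / (2 * P.b k)
  let n : ℂ := ν k ^ 2
  let m : ℂ := (starRingEnd ℂ) (ν k) ^ 2
  ![-(c * n * a 1) - d * n * a 3, c * m * a 1 - d * m * a 3,
    c * m * a 0 + d * m * a 2, -(c * n * a 0) + d * n * a 2]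

theorem sum_smul_rieszVector (ν : ℕ → ℂ) (a : EuclideanSpace ℂ (Fin 4)) (k : ℕ) :
    ∑ i, a i • P.rieszVector ν k i = ∑ i, P.eigenCoeff ν a k i • P.theta (P.sigma ν k i) := by
  simp only [Fin.sum_univ_four, rieszVector, eigenCoeff, Matrix.cons_val_zero, Matrix.cons_val_one,
    Matrix.cons_val]
  module

-- The change of coefficients splits into two 2×2 blocks with rows proportional to (c, d) and (-c,
-- d). They are invertible because ν_k and Re ν_k are nonzero.
variable {P} in
theorem IsLabelling.eq_zero_of_eigenCoeff_eq_zero {ν : ℕ → ℂ} (hν : P.IsLabelling ν)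
    {a : EuclideanSpace ℂ (Fin 4)} {k : ℕ} (h : P.eigenCoeff ν a k = 0) : a = 0 := by
  have hr := hν.re_ne_zero k
  have hν0 : ν k ≠ 0 := fun h => hr (by simp [h])
  have hm : (starRingEnd ℂ) (ν k) ≠ 0 := by simpa using hν0
  have hb : (P.b k : ℂ) ≠ 0 := by exact_mod_cast P.b_ne_zero k
  have hrc : ((ν k).re : ℂ) ≠ 0 := by exact_mod_cast hr
  have e0 := congrFun h 0
  have e1 := congrFun h 1
  have e2 := congrFun h 2
  have e3 := congrFun h 3
  simp only [eigenCoeff, Matrix.cons_val_zero, Matrix.cons_val_one, Matrix.cons_val,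
    Pi.zero_apply] at e0 e1 e2 e3
  have hc : (1 / (2 * P.b k * (ν k).re) : ℂ) ≠ 0 := one_div_ne_zero
    (mul_ne_zero (mul_ne_zero two_ne_zero hb) hrc)
  have hd : (1 / (2 * P.b k) : ℂ) ≠ 0 := one_div_ne_zero (mul_ne_zero two_ne_zero hb)
  generalize (1 / (2 * P.b k * (ν k).re) : ℂ) = c at *
  generalize (1 / (2 * P.b k) : ℂ) = d at *
  have key : ∀ n m x y : ℂ, n ≠ 0 → m ≠ 0 → c * m ^ 2 * x + d * m ^ 2 * y = 0 →
      -(c * n ^ 2 * x) + d * n ^ 2 * y = 0 → x = 0 ∧ y = 0 := by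
    intro n m x y hn hm h1 h2
    have h3 : c * x + d * y = 0 := (mul_eq_zero.1 (show m ^ 2 * (c * x + d * y) = 0 by
      linear_combination h1)).resolve_left (pow_ne_zero 2 hm)
    have h4 : -(c * x) + d * y = 0 := (mul_eq_zero.1 (show n ^ 2 * (-(c * x) + d * y) = 0 by
      linear_combination h2)).resolve_left (pow_ne_zero 2 hn)
    exact ⟨(mul_eq_zero.1 (show c * x = 0 by linear_combination (h3 - h4) / 2)).resolve_left hc,
      (mul_eq_zero.1 (show d * y = 0 by linear_combination (h3 + h4) / 2)).resolve_left hd⟩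
  obtain ⟨a0, a2⟩ := key _ _ _ _ hν0 hm e2 e3
  obtain ⟨a1, a3⟩ := key _ _ (a 1) (-a 3) hν0 hm (by linear_combination e1) (by linear_combination e0)
  rw [neg_eq_zero] at a3
  ext i
  fin_cases i <;> assumption

end Oscillator

/-! ### The standard basis of the state space -/

/-- The unit vectors of the state space. -/
noncomputable def StateSpace.unit (n : ℕ × Fin 4) : StateSpace :=
  lp.single 2 n.1 (EuclideanSpace.single n.2 1)

namespace StateSpace

theorem unit_apply_self (k : ℕ) (i : Fin 4) : unit (k, i) k = EuclideanSpace.single i 1 :=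
  lp.single_apply_self ..

theorem unit_apply_ne {j k : ℕ} (h : j ≠ k) (i : Fin 4) : unit (k, i) j = 0 :=
  lp.single_apply_ne _ _ _ h

/-- The coordinate functionals of the state space. -/
noncomputable def coord (n : ℕ × Fin 4) : StateSpace →L[ℂ] ℂ := innerSL ℂ (unit n)

theorem coord_apply (n : ℕ × Fin 4) (a : StateSpace) : coord n a = a n.1 n.2 := by
  rw [coord, innerSL_apply_apply, unit, lp.inner_single_left, EuclideanSpace.inner_single_left]
  simp

theorem orthonormal_unit : Orthonormal ℂ unit := by
  classical
  rw [orthonormal_iff_ite]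
  intro n m
  have h : inner ℂ (unit n) (unit m) = unit m n.1 n.2 := coord_apply n (unit m)
  rw [h]
  obtain ⟨k, i⟩ := n
  obtain ⟨l, j⟩ := m
  by_cases hkl : k = l
  · subst hkl
    simp [unit_apply_self, Prod.ext_iff]
  · rw [unit_apply_ne hkl, if_neg fun h => hkl (congrArg Prod.fst h)]
    rfl

theorem span_unit_orthogonal : (Submodule.span ℂ (Set.range unit))ᗮ = ⊥ := by
  rw [Submodule.eq_bot_iff]
  intro a ha
  ext k i
  have h := (Submodule.mem_orthogonal _ _).1 ha (unit (k, i))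
    (Submodule.subset_span ⟨(k, i), rfl⟩)
  exact (coord_apply (k, i) a).symm.trans h

/-- The Hilbert basis of unit vectors. -/
noncomputable def basis : HilbertBasis (ℕ × Fin 4) ℂ StateSpace :=
  HilbertBasis.mkOfOrthogonalEqBot orthonormal_unit span_unit_orthogonal

theorem basis_repr_apply (a : StateSpace) (n : ℕ × Fin 4) : basis.repr a n = coord n a := by
  rw [HilbertBasis.repr_apply_apply, basis, HilbertBasis.coe_mkOfOrthogonalEqBot]
  rfl

theorem hasSum_coord_smul_unit (a : StateSpace) : HasSum (fun n => coord n a • unit n) a := by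
  have h := basis.hasSum_repr a
  simp only [basis_repr_apply] at h
  simpa only [basis, HilbertBasis.coe_mkOfOrthogonalEqBot] using h

theorem hasSum_norm_coord_sq (a : StateSpace) :
    HasSum (fun n => ‖coord n a‖ ^ 2) (‖a‖ ^ 2) := by
  have h := lp.hasSum_norm (p := 2) (by norm_num) (basis.repr a)
  simpa [basis_repr_apply] using h

theorem hasSum_norm_sq (a : StateSpace) : HasSum (fun k => ‖a k‖ ^ 2) (‖a‖ ^ 2) := by
  simpa using lp.hasSum_norm (p := 2) (by norm_num) a

end StateSpace

/-! ### Linear independence of the Riesz vectors -/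

theorem Summable.hasSum_of_hasSum_sum {α β E : Type*} [Fintype β] [NormedAddCommGroup E]
    {f : α × β → E} (hf : Summable f) {s : E} (h : HasSum (fun k => ∑ i, f (k, i)) s) :
    HasSum f s := by
  have h1 := hf.hasSum.prod_fiberwise fun k => hasSum_fintype fun i => f (k, i)
  rw [← h1.unique h]
  exact hf.hasSum

namespace Oscillator

variable {P : Oscillator} {ν : ℕ → ℂ}

open StateSpace in
/-- The Riesz vectors are `ω`-linearly independent. -/
theorem IsLabelling.eq_zero_of_hasSum_rieszVector (hν : P.IsLabelling ν) (hA4 : P.A4)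
    {a : StateSpace} (h : HasSum (fun x : ℕ × Fin 4 => a x.1 x.2 • P.rieszVector ν x.1 x.2) 0) :
    a = 0 := by
  set s : ℕ × Fin 4 → ℂ := fun x => P.sigma ν x.1 x.2 with hs
  set c : ℕ × Fin 4 → ℂ := fun x => P.eigenCoeff ν (a x.1) x.1 x.2 with hcdef
  have hlim : Tendsto (fun n => ‖s n‖) cofinite atTop := hν.tendsto_norm_sigma
  obtain ⟨ωs, hωs, -, hω⟩ := P.exists_gap
  -- The coefficients are at most `5 * ‖a k‖` and the eigenvalues grow at least linearly in `k`, so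
  -- the quotients are dominated by a product of two ℓ² sequences.
  have hc : Summable fun n => ‖c n‖ / (1 + ‖s n‖) := by
    have hg : Summable fun k : ℕ => 5 / ωs * (‖a k‖ ^ 2 + 1 / (k : ℝ) ^ 2) :=
      ((hasSum_norm_sq a).summable.add (Real.summable_one_div_nat_pow.2 one_lt_two)).mul_left _
    refine summable_prod_of_eventually_norm_le hg ?_
    filter_upwards [hν.eventually_bounds one_pos, hν.eventually_coeff_le, eventually_ge_atTop 1]
      with k hk hco hk1 i
    have hkpos : (0 : ℝ) < k := by exact_mod_cast hk1
    have h1 : k * ωs ≤ 1 + ‖s (k, i)‖ := by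
      have := P.le_norm_sigma ν k i
      simp only [hs]
      linarith [hω k, hk.2.1]
    have h2 : ‖c (k, i)‖ ≤ 5 * ‖a k‖ := by
      obtain ⟨m1, m2⟩ := hco ((starRingEnd ℂ) (ν k)) (by simp)
      obtain ⟨n1, n2⟩ := hco (ν k) rfl
      have ha := fun i => PiLp.norm_apply_le (a k) i
      have key : ∀ x y : ℂ, ‖x‖ ≤ 5 / 2 → ‖y‖ ≤ 5 / 2 → ∀ i l,
          ‖x * a k i + y * a k l‖ ≤ 5 * ‖a k‖ := by
        intro x y hx hy i l
        have h3 : ‖x * a k i‖ ≤ 5 / 2 * ‖a k‖ := by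
          rw [norm_mul]; gcongr; exact ha i
        have h4 : ‖y * a k l‖ ≤ 5 / 2 * ‖a k‖ := by
          rw [norm_mul]; gcongr; exact ha l
        linarith [norm_add_le (x * a k i) (y * a k l)]
      have hneg : ∀ x : ℂ, ‖x‖ ≤ 5 / 2 → ‖-x‖ ≤ 5 / 2 := fun x hx => by rwa [norm_neg]
      fin_cases i
      · convert key _ _ (hneg _ n1) (hneg _ n2) 1 3 using 2
        simp [hcdef, eigenCoeff]
        ring
      · convert key _ _ m1 (hneg _ m2) 1 3 using 2
        simp [hcdef, eigenCoeff]
        ring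
      · exact key _ _ m1 m2 0 2
      · convert key _ _ (hneg _ n1) n2 0 2 using 2
        simp [hcdef, eigenCoeff]
    have hpos : 0 < 1 + ‖s (k, i)‖ := by positivity
    rw [Real.norm_of_nonneg (by positivity)]
    have hkω : 0 < k * ωs := by positivity
    calc ‖c (k, i)‖ / (1 + ‖s (k, i)‖) ≤ 5 * ‖a k‖ / (k * ωs) := by gcongr
      _ = 5 / ωs * (‖a k‖ * (1 / k)) := by field_simp
      _ ≤ 5 / ωs * (‖a k‖ ^ 2 + 1 / (k : ℝ) ^ 2) := by
        gcongr
        have h3 : 1 / (k : ℝ) ^ 2 = (1 / k) ^ 2 := by ring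
        rw [h3]
        nlinarith [sq_nonneg (‖a k‖ - 1 / k), sq_nonneg (‖a k‖), sq_nonneg (1 / (k : ℝ))]
  have hmem : ∀ n, s n ∈ P.nonresonant := fun n => (hν.eigenvalue n.1 n.2).charSum_eq.1
  have hb : ∀ j, (P.b j : ℂ) ≠ 0 := fun j => by exact_mod_cast P.b_ne_zero j
  -- At this stage convergence is known only for the groups of four eigenvectors with the same `k`.
  have hco : ∀ j l, HasSum (fun k => ∑ i, c (k, i) * P.thetaSeq (s (k, i)) j l) 0 := by
    intro j l
    have h1 := (h.mapL (coord (j, l))).prod_fiberwise fun k => hasSum_fintype _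
    rw [map_zero] at h1
    convert! h1 using 2 with k
    simp only [← map_sum]
    rw [P.sum_smul_rieszVector, map_sum]
    refine Finset.sum_congr rfl fun i _ => ?_
    rw [map_smul, coord_apply]
    rfl
  have hne1 : ∀ j n, s n ≠ -(Complex.I * P.ω j) := fun j n h => (hmem n j).1 (by rw [h]; ring)
  have hne2 : ∀ j n, s n ≠ Complex.I * P.ω j := fun j n h => (hmem n j).2 (by rw [h]; ring)
  -- Absolute convergence allows the groups to be split; `ε` is the sign of the coordinate in θ(σ).
  have hdiv : ∀ (j : ℕ) (l : Fin 4) (g : ℕ × Fin 4 → ℂ) (ε : ℂ), ε ≠ 0 →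
      (∀ n, P.thetaSeq (s n) j l = ε * (P.b j / g n)) →
      (Summable fun n => ‖c n / g n‖) → HasSum (fun n => c n / g n) 0 := by
    intro j l g ε hε hg hsum
    have h1 : ∀ n, c n * P.thetaSeq (s n) j l = ε * P.b j * (c n / g n) := fun n => by
      rw [hg]; ring
    have h2 := hco j l
    simp only [h1, ← Finset.mul_sum] at h2
    have h3 := h2.mul_left (ε * P.b j)⁻¹
    simp only [inv_mul_cancel_left₀ (mul_ne_zero hε (hb j)), mul_zero] at h3
    exact hsum.of_norm.hasSum_of_hasSum_sum h3
  have hc0 : c = 0 := by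
    refine P.eq_zero_of_hasSum (fun x y hxy => hν.injective hxy) hlim hc hmem
      (fun n => (hν.eigenvalue n.1 n.2).charSum_eq.2) (hν.exists_tsum_charTerm_le hA4)
      (fun j => hdiv j 0 _ 1 one_ne_zero (fun n => by simp [thetaSeq]; rfl) ?_)
      (fun j => hdiv j 1 _ (-1) (by simp) (fun n => by simp [thetaSeq]; rfl) ?_)
      (fun j => hdiv j 2 _ 1 one_ne_zero (fun n => by simp [thetaSeq]; rfl) ?_)
      (fun j => hdiv j 3 _ (-1) (by simp) (fun n => by simp [thetaSeq]; rfl) ?_)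
    · have h1 := summable_div_sub hlim hc (hne1 j)
      convert! h1 using 2 with n
      rw [norm_div, norm_div, ← neg_add', norm_neg, add_comm]
    · have h1 := summable_div_sub hlim hc (hne2 j)
      convert! h1 using 2 with n
      rw [norm_div, norm_div, norm_sub_rev]
    · have h1 := summable_div_sub_sq hlim hc (hne1 j)
      convert! h1 using 3 with n
      ring
    · have h1 := summable_div_sub_sq hlim hc (hne2 j)
      convert! h1 using 3 with n
      ring
  have hz : ∀ k, a k = 0 := fun k => hν.eq_zero_of_eigenCoeff_eq_zero
    (funext fun i => congrFun hc0 (k, i))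
  ext k : 2
  exact hz k

end Oscillator

/-! ### Entries of the Riesz vectors -/

namespace EuclideanSpace

theorem norm_le_sum_norm {ι : Type*} [Fintype ι] (v : EuclideanSpace ℂ ι) :
    ‖v‖ ≤ ∑ i, ‖v i‖ := by
  rw [EuclideanSpace.norm_eq]
  refine Real.sqrt_le_iff.2 ⟨Finset.sum_nonneg fun i _ => norm_nonneg _, ?_⟩
  exact Finset.sum_sq_le_sq_sum_of_nonneg fun i _ => norm_nonneg _

end EuclideanSpace

namespace Oscillator

variable (P : Oscillator)

theorem norm_thetaSeq_le {σ : ℂ} {j : ℕ} {δ : ℝ} (hδ : 0 < δ) (h1 : δ ≤ ‖σ + Complex.I * P.ω j‖)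
    (h2 : δ ≤ ‖σ - Complex.I * P.ω j‖) :
    ‖P.thetaSeq σ j‖ ≤ |P.b j| * (2 / δ + 2 / δ ^ 2) := by
  refine (EuclideanSpace.norm_le_sum_norm _).trans ?_
  rw [Fin.sum_univ_four]
  simp only [thetaSeq, PiLp.toLp_apply, Matrix.cons_val_zero, Matrix.cons_val_one, Matrix.cons_val,
    norm_neg, norm_div, norm_pow, Complex.norm_real, Real.norm_eq_abs]
  have e1 : |P.b j| / ‖σ + Complex.I * P.ω j‖ ≤ |P.b j| / δ := by gcongr
  have e2 : |P.b j| / ‖σ - Complex.I * P.ω j‖ ≤ |P.b j| / δ := by gcongr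
  have e3 : |P.b j| / ‖σ + Complex.I * P.ω j‖ ^ 2 ≤ |P.b j| / δ ^ 2 := by gcongr
  have e4 : |P.b j| / ‖σ - Complex.I * P.ω j‖ ^ 2 ≤ |P.b j| / δ ^ 2 := by gcongr
  have e5 : |P.b j| * (2 / δ + 2 / δ ^ 2)
      = |P.b j| / δ + |P.b j| / δ + |P.b j| / δ ^ 2 + |P.b j| / δ ^ 2 := by ring
  linarith

theorem rieszVector_apply (ν : ℕ → ℂ) (k j : ℕ) :
    let c : ℂ := 1 / (2 * P.b k * (ν k).re)
    let d : ℂ := 1 / (2 * P.b k)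
    let n : ℂ := ν k ^ 2
    let m : ℂ := (starRingEnd ℂ) (ν k) ^ 2
    P.rieszVector ν k 0 j
        = (c * m) • P.thetaSeq (P.sigma ν k 2) j + (-(c * n)) • P.thetaSeq (P.sigma ν k 3) j ∧
      P.rieszVector ν k 1 j
        = (-(c * n)) • P.thetaSeq (P.sigma ν k 0) j + (c * m) • P.thetaSeq (P.sigma ν k 1) j ∧
      P.rieszVector ν k 2 j
        = (d * m) • P.thetaSeq (P.sigma ν k 2) j + (d * n) • P.thetaSeq (P.sigma ν k 3) j ∧
      P.rieszVector ν k 3 j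
        = (-(d * n)) • P.thetaSeq (P.sigma ν k 0) j + (-(d * m)) • P.thetaSeq (P.sigma ν k 1) j := by
  intro c d n m
  have h : ∀ σ, (P.theta σ : ℕ → EuclideanSpace ℂ (Fin 4)) j = P.thetaSeq σ j := fun _ => rfl
  refine ⟨?_, ?_, ?_, ?_⟩ <;>
  · simp only [rieszVector, Matrix.cons_val_zero, Matrix.cons_val_one, Matrix.cons_val,
      lp.coeFn_smul, lp.coeFn_sub, lp.coeFn_add, lp.coeFn_neg, Pi.smul_apply, Pi.sub_apply,
      Pi.add_apply, Pi.neg_apply, h]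
    simp only [c, d, n, m]
    module

variable {P} {ν : ℕ → ℂ}

theorem norm_smul_add_smul_le {E : Type*} [NormedAddCommGroup E] [NormedSpace ℂ E] {x y : ℂ}
    {v w : E} {t : ℝ} (hx : ‖x‖ ≤ 5 / 2) (hy : ‖y‖ ≤ 5 / 2) (hv : ‖v‖ ≤ t) (hw : ‖w‖ ≤ t) :
    ‖x • v + y • w‖ ≤ 5 * t := by
  have h1 : ‖x • v‖ ≤ 5 / 2 * t := by
    rw [norm_smul]
    exact mul_le_mul hx hv (norm_nonneg _) (by norm_num)
  have h2 : ‖y • w‖ ≤ 5 / 2 * t := by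
    rw [norm_smul]
    exact mul_le_mul hy hw (norm_nonneg _) (by norm_num)
  linarith [norm_add_le (x • v) (y • w)]

theorem IsLabelling.eventually_coeffs (hν : P.IsLabelling ν) : ∀ᶠ k in atTop,
    ‖(1 / (2 * P.b k * (ν k).re) : ℂ) * (starRingEnd ℂ) (ν k) ^ 2‖ ≤ 5 / 2 ∧
    ‖-((1 / (2 * P.b k * (ν k).re) : ℂ) * ν k ^ 2)‖ ≤ 5 / 2 ∧
    ‖(1 / (2 * P.b k) : ℂ) * (starRingEnd ℂ) (ν k) ^ 2‖ ≤ 5 / 2 ∧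
    ‖(1 / (2 * P.b k) : ℂ) * ν k ^ 2‖ ≤ 5 / 2 := by
  filter_upwards [hν.eventually_coeff_le] with k hco
  obtain ⟨m1, m2⟩ := hco ((starRingEnd ℂ) (ν k)) (by simp)
  obtain ⟨n1, n2⟩ := hco (ν k) rfl
  exact ⟨m1, by rwa [norm_neg], m2, n2⟩

/-- The entries of the Riesz vectors off the diagonal. -/
theorem IsLabelling.exists_norm_rieszVector_le (hν : P.IsLabelling ν) : ∃ K : ℝ, 0 ≤ K ∧
    ∀ᶠ k in atTop, ∀ i j, j ≠ k → ‖P.rieszVector ν k i j‖ ≤ K * (|P.b j| / |P.ω j - P.ω k|) := by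
  obtain ⟨ωs, hωs, hgap, -⟩ := P.exists_gap
  refine ⟨5 * (4 * (1 + 2 / ωs)), by positivity, ?_⟩
  filter_upwards [hν.eventually_dist, hν.eventually_coeffs] with k hk hco i j hj
  obtain ⟨c1, c2, c3, c4⟩ := hco
  have hg := hgap j k hj
  set D := |P.ω j - P.ω k| with hD
  have hD0 : 0 < D := hωs.trans_le hg
  have ht : ∀ i, ‖P.thetaSeq (P.sigma ν k i) j‖ ≤ 4 * (1 + 2 / ωs) * (|P.b j| / D) := by
    intro i
    obtain ⟨h0, h1, h2⟩ := hk i j hj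
    refine (P.norm_thetaSeq_le h0 h1 h2).trans ?_
    have e1 : 2 / (D / 2) + 2 / (D / 2) ^ 2 = 4 * (1 + 2 / D) / D := by field_simp; ring
    rw [e1, mul_comm (4 * _), div_mul_eq_mul_div, ← mul_div_assoc]
    gcongr
  rw [mul_assoc]
  obtain ⟨r0, r1, r2, r3⟩ := P.rieszVector_apply ν k j
  fin_cases i
  · exact r0 ▸ norm_smul_add_smul_le c1 c2 (ht 2) (ht 3)
  · exact r1 ▸ norm_smul_add_smul_le c2 c1 (ht 0) (ht 1)
  · exact r2 ▸ norm_smul_add_smul_le c3 c4 (ht 2) (ht 3)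
  · exact r3 ▸ norm_smul_add_smul_le (by rwa [norm_neg]) (by rwa [norm_neg]) (ht 0) (ht 1)

/-- The diagonal entries of the Riesz vectors. -/
theorem IsLabelling.exists_norm_rieszVector_sub_le (hν : P.IsLabelling ν) : ∃ K : ℝ, 0 ≤ K ∧
    ∀ᶠ k in atTop, ∀ i, ‖P.rieszVector ν k i k - EuclideanSpace.single i 1‖ ≤ K * |P.b k| := by
  have hω0 := P.ω_pos
  refine ⟨2 + 5 * (1 / P.ω 0) + 5 * (1 / P.ω 0 ^ 2), by positivity, ?_⟩
  filter_upwards [hν.eventually_bounds hω0, hν.eventually_coeffs] with k hk hco i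
  obtain ⟨c1, c2, c3, c4⟩ := hco
  obtain ⟨f0, f1, f2, f3⟩ := P.dist_sigma_self hk.2.1
  have hb : (P.b k : ℂ) ≠ 0 := by exact_mod_cast P.b_ne_zero k
  have hr := hν.re_ne_zero k
  have hν0 : ν k ≠ 0 := fun h => hr (by simp [h])
  have hm0 : (starRingEnd ℂ) (ν k) ≠ 0 := by simpa using hν0
  have hrc : ((ν k).re : ℂ) ≠ 0 := by exact_mod_cast hr
  have hre : ν k = 2 * (ν k).re - (starRingEnd ℂ) (ν k) := by
    rw [eq_sub_iff_add_eq, Complex.add_conj]; push_cast; ring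
  -- These denominators are small, and the weights ν², ν̄² cancel them. The double poles contribute
  -- exactly 0 or 1. The simple poles contribute (ν + ν̄) / (2 Re ν) = 1 to θ^z and θ^ζ, and ± (ν̄ -
  -- ν) / 2 = O(|b_k|) to θ^p and θ^q.
  have near0 : P.sigma ν k 0 - Complex.I * P.ω k = ν k := by simp [sigma]
  have near1 : P.sigma ν k 1 - Complex.I * P.ω k = -(starRingEnd ℂ) (ν k) := by simp [sigma]
  have near2 : P.sigma ν k 2 + Complex.I * P.ω k = (starRingEnd ℂ) (ν k) := by simp [sigma]
  have near3 : P.sigma ν k 3 + Complex.I * P.ω k = -ν k := by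
    simp only [sigma, Matrix.cons_val]; ring
  have himag : ‖((starRingEnd ℂ) (ν k) - ν k) / 2‖ ≤ 2 * |P.b k| := by
    have h1 := norm_sub_le ((starRingEnd ℂ) (ν k)) (ν k)
    rw [RCLike.norm_conj] at h1
    rw [norm_div, Complex.norm_ofNat]
    linarith [hk.2.2.1]
  have himag' : ‖(ν k - (starRingEnd ℂ) (ν k)) / 2‖ ≤ 2 * |P.b k| := by
    rwa [norm_div, norm_sub_rev, ← norm_div]
  have hfar : ∀ z : ℂ, P.ω 0 ≤ ‖z‖ → ‖(P.b k : ℂ) / z‖ ≤ 1 / P.ω 0 * |P.b k| ∧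
      ‖-((P.b k : ℂ) / z)‖ ≤ 1 / P.ω 0 * |P.b k| ∧
      ‖(P.b k : ℂ) / z ^ 2‖ ≤ 1 / P.ω 0 ^ 2 * |P.b k| ∧
      ‖-((P.b k : ℂ) / z ^ 2)‖ ≤ 1 / P.ω 0 ^ 2 * |P.b k| := by
    intro z hz
    simp only [norm_neg, norm_div, norm_pow, Complex.norm_real, Real.norm_eq_abs,
      one_div_mul_eq_div]
    have h1 : |P.b k| / ‖z‖ ≤ |P.b k| / P.ω 0 := by gcongr
    have h2 : |P.b k| / ‖z‖ ^ 2 ≤ |P.b k| / P.ω 0 ^ 2 := by gcongr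
    exact ⟨h1, h1, h2, h2⟩
  have htot : ∀ w x y z : ℂ, ‖w‖ ≤ 2 * |P.b k| → x = 0 → ‖y‖ ≤ 5 * (1 / P.ω 0 * |P.b k|) →
      ‖z‖ ≤ 5 * (1 / P.ω 0 ^ 2 * |P.b k|) → 
      ‖w‖ + ‖y‖ + ‖x‖ + ‖z‖ ≤ (2 + 5 * (1 / P.ω 0) + 5 * (1 / P.ω 0 ^ 2)) * |P.b k| ∧
      ‖y‖ + ‖w‖ + ‖z‖ + ‖x‖ ≤ (2 + 5 * (1 / P.ω 0) + 5 * (1 / P.ω 0 ^ 2)) * |P.b k| := by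
    intro w x y z hw hx hy hz
    rw [hx, norm_zero]
    constructor <;> linarith
  have hzero : ‖(0 : ℂ)‖ ≤ 2 * |P.b k| := by rw [norm_zero]; positivity
  obtain ⟨r0, r1, r2, r3⟩ := P.rieszVector_apply ν k k
  have hcoord : ∀ (x y : ℂ) (v w u : EuclideanSpace ℂ (Fin 4)) (l : Fin 4),
      (x • v + y • w - u) l = x • v l + y • w l - u l := fun _ _ _ _ _ _ => rfl
  have hsum : ∀ v : EuclideanSpace ℂ (Fin 4), ‖v‖ ≤ ‖v 0‖ + ‖v 1‖ + ‖v 2‖ + ‖v 3‖ := fun v => by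
    have h := EuclideanSpace.norm_le_sum_norm v
    rwa [Fin.sum_univ_four] at h
  fin_cases i
  · change ‖P.rieszVector ν k 0 k - EuclideanSpace.single 0 1‖ ≤ _
    rw [r0]
    refine (hsum _).trans ?_
    simp only [hcoord]
    refine (htot _ _ _ _ ?_ ?_ ?_ ?_).1
    · convert hzero using 2
      simp [thetaSeq, near2, near3]
      field_simp
      linear_combination hre
    · simp [thetaSeq, near2, near3]
      field_simp
      ring
    · rw [show (EuclideanSpace.single 0 (1 : ℂ) : EuclideanSpace ℂ (Fin 4)) 1 = 0 by simp, sub_zero]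
      exact norm_smul_add_smul_le c1 c2 (hfar _ f2).2.1 (hfar _ f3).2.1
    · rw [show (EuclideanSpace.single 0 (1 : ℂ) : EuclideanSpace ℂ (Fin 4)) 3 = 0 by simp, sub_zero]
      exact norm_smul_add_smul_le c1 c2 (hfar _ f2).2.2.2 (hfar _ f3).2.2.2
  · change ‖P.rieszVector ν k 1 k - EuclideanSpace.single 1 1‖ ≤ _
    rw [r1]
    refine (hsum _).trans ?_
    simp only [hcoord]
    refine (htot _ _ _ _ ?_ ?_ ?_ ?_).2
    · convert hzero using 2
      simp [thetaSeq, near0, near1]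
      field_simp
      linear_combination hre
    · simp [thetaSeq, near0, near1]
      field_simp
      ring
    · rw [show (EuclideanSpace.single 1 (1 : ℂ) : EuclideanSpace ℂ (Fin 4)) 0 = 0 by simp, sub_zero]
      exact norm_smul_add_smul_le c2 c1 (hfar _ f0).1 (hfar _ f1).1
    · rw [show (EuclideanSpace.single 1 (1 : ℂ) : EuclideanSpace ℂ (Fin 4)) 2 = 0 by simp, sub_zero]
      exact norm_smul_add_smul_le c2 c1 (hfar _ f0).2.2.1 (hfar _ f1).2.2.1
  · change ‖P.rieszVector ν k 2 k - EuclideanSpace.single 2 1‖ ≤ _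
    rw [r2]
    refine (hsum _).trans ?_
    simp only [hcoord]
    refine (htot _ _ _ _ ?_ ?_ ?_ ?_).1
    · convert himag using 2
      simp [thetaSeq, near2, near3]
      field_simp
      ring
    · simp [thetaSeq, near2, near3]
      field_simp
      ring
    · rw [show (EuclideanSpace.single 2 (1 : ℂ) : EuclideanSpace ℂ (Fin 4)) 1 = 0 by simp, sub_zero]
      exact norm_smul_add_smul_le c3 c4 (hfar _ f2).2.1 (hfar _ f3).2.1
    · rw [show (EuclideanSpace.single 2 (1 : ℂ) : EuclideanSpace ℂ (Fin 4)) 3 = 0 by simp, sub_zero]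
      exact norm_smul_add_smul_le c3 c4 (hfar _ f2).2.2.2 (hfar _ f3).2.2.2
  · change ‖P.rieszVector ν k 3 k - EuclideanSpace.single 3 1‖ ≤ _
    rw [r3]
    refine (hsum _).trans ?_
    simp only [hcoord]
    refine (htot _ _ _ _ ?_ ?_ ?_ ?_).2
    · convert himag' using 2
      simp [thetaSeq, near0, near1]
      field_simp
      ring
    · simp [thetaSeq, near0, near1]
      field_simp
      ring
    · rw [show (EuclideanSpace.single 3 (1 : ℂ) : EuclideanSpace ℂ (Fin 4)) 0 = 0 by simp, sub_zero]
      exact norm_smul_add_smul_le (by rwa [norm_neg]) (by rwa [norm_neg]) (hfar _ f0).1 (hfar _ f1).1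
    · rw [show (EuclideanSpace.single 3 (1 : ℂ) : EuclideanSpace ℂ (Fin 4)) 2 = 0 by simp, sub_zero]
      exact norm_smul_add_smul_le (by rwa [norm_neg]) (by rwa [norm_neg]) (hfar _ f0).2.2.1 (hfar _ f1).2.2.1

end Oscillator

/-! ### Weighted closeness and bijectivity -/

namespace Oscillator

variable (P : Oscillator)

theorem exists_rpow_le {ρ : ℝ} (hρ : 0 ≤ ρ) : ∃ M : ℝ, 0 ≤ M ∧ ∀ k, |P.b k| ^ ρ ≤ M := by
  obtain ⟨B, hB⟩ := P.tendsto_abs_b.bddAbove_range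
  have hB' : ∀ k, |P.b k| ≤ B := fun k => hB ⟨k, rfl⟩
  exact ⟨B ^ ρ, Real.rpow_nonneg ((abs_nonneg _).trans (hB' 0)) _, fun k =>
    Real.rpow_le_rpow (abs_nonneg _) (hB' k) hρ⟩

/-- The diagonal operator that multiplies the `k`-th entry by `|b_k| ^ ρ`. -/
theorem exists_diagonal {ρ : ℝ} (hρ : 0 ≤ ρ) : ∃ D : StateSpace →L[ℂ] StateSpace,
    ∀ a k, D a k = ((|P.b k| ^ ρ : ℝ) : ℂ) • a k := by
  obtain ⟨M, hM, hb⟩ := P.exists_rpow_le hρ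
  have hle : ∀ (a : StateSpace) k,
      ‖((|P.b k| ^ ρ : ℝ) : ℂ) • a k‖ ^ 2 ≤ M ^ 2 * ‖a k‖ ^ 2 := by
    intro a k
    rw [norm_smul, mul_pow, Complex.norm_real,
      Real.norm_of_nonneg (Real.rpow_nonneg (abs_nonneg _) _)]
    gcongr
    exact hb k
  have hs : ∀ a : StateSpace, Summable fun k => M ^ 2 * ‖a k‖ ^ 2 := fun a =>
    (StateSpace.hasSum_norm_sq a).summable.mul_left _
  have hmem : ∀ a : StateSpace, Memℓp (fun k => ((|P.b k| ^ ρ : ℝ) : ℂ) • a k) 2 := fun a => by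
    refine memℓp_gen ?_
    simpa using Summable.of_nonneg_of_le (fun k => sq_nonneg _) (hle a) (hs a)
  let L : StateSpace →ₗ[ℂ] StateSpace :=
    { toFun := fun a => ⟨_, hmem a⟩
      map_add' := fun a b => by
        ext k : 2
        exact smul_add _ (a k) (b k)
      map_smul' := fun c a => by
        ext k : 2
        exact smul_comm _ c (a k) }
  have hL : ∀ a, ‖L a‖ ≤ M * ‖a‖ := fun a => by
    refine abs_le_of_sq_le_sq' ?_ (by positivity) |>.2
    rw [mul_pow]
    exact hasSum_le (hle a) (StateSpace.hasSum_norm_sq (L a))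
      ((StateSpace.hasSum_norm_sq a).mul_left _)
  exact ⟨L.mkContinuous M hL, fun _ _ => rfl⟩

/-- This makes the Riesz basis property in X the case ρ = 0 of the weighted estimate, with the
identity as diagonal operator. -/
theorem a5_zero_of_a4 (h : P.A4) : P.A5 0 := by
  unfold A4 at h
  unfold A5
  convert h using 3 with x
  simp

variable {P} {ν : ℕ → ℂ} {ρ : ℝ}

open StateSpace in
/-- The rescaled Riesz vectors are square-summably close to the unit vectors. -/
theorem IsLabelling.summable_norm_sub_unit_sq (hν : P.IsLabelling ν) (hA5 : P.A5 ρ)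
    {D : StateSpace →L[ℂ] StateSpace} (hD : ∀ a k, D a k = ((|P.b k| ^ ρ : ℝ) : ℂ) • a k) :
    Summable fun x : ℕ × Fin 4 =>
      ‖((|P.b x.1| ^ (-ρ) : ℝ) : ℂ) • D (P.rieszVector ν x.1 x.2) - unit x‖ ^ 2 := by
  obtain ⟨K, hK, hoff⟩ := hν.exists_norm_rieszVector_le
  obtain ⟨L, hL, hdiag⟩ := hν.exists_norm_rieszVector_sub_le
  let t : ℕ → ℕ → ℝ := fun k j => if j = k then 0
    else 1 / |P.b k| ^ (2 * ρ) * (|P.b j| ^ (2 * (1 + ρ)) / (P.ω j - P.ω k) ^ 2)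
  have ht : ∀ k, Summable (t k) := fun k => hA5.prod_factor k
  have hg : Summable fun k => L ^ 2 * P.b k ^ 2 + K ^ 2 * ∑' j, t k j :=
    (P.summable_sq.mul_left _).add (hA5.prod.mul_left _)
  refine summable_prod_of_eventually_norm_le hg ?_
  filter_upwards [hoff, hdiag] with k h1 h2 i
  rw [Real.norm_of_nonneg (sq_nonneg _)]
  have hpos : ∀ l, 0 < |P.b l| := fun l => abs_pos.2 (P.b_ne_zero l)
  have hrp : ∀ l, 0 < |P.b l| ^ ρ := fun l => Real.rpow_pos_of_pos (hpos l) _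
  -- At `j = k` the weights cancel and the diagonal bound remains. At `j ≠ k` the factor |b_j|^ρ /
  -- |b_k|^ρ times the off-diagonal bound squares to `K ^ 2` times a term of `A5`.
  refine hasSum_le (fun j => ?_) (hasSum_norm_sq _)
    ((hasSum_ite_eq k (L ^ 2 * P.b k ^ 2)).add ((ht k).hasSum.mul_left (K ^ 2)))
  have hentry : (((|P.b k| ^ (-ρ) : ℝ) : ℂ) • D (P.rieszVector ν k i) - unit (k, i)) j
      = ((|P.b j| ^ ρ / |P.b k| ^ ρ : ℝ) : ℂ) • P.rieszVector ν k i j - unit (k, i) j := by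
    rw [lp.coeFn_sub, Pi.sub_apply, lp.coeFn_smul, Pi.smul_apply, hD, smul_smul,
      Real.rpow_neg (abs_nonneg _), ← Complex.ofReal_mul, div_eq_inv_mul]
  rw [hentry]
  by_cases hj : j = k
  · subst hj
    have h3 := h2 i
    rw [unit_apply_self, div_self (hrp j).ne', Complex.ofReal_one, one_smul]
    simp only [t, if_true, mul_zero, add_zero]
    calc _ ≤ (L * |P.b j|) ^ 2 := by gcongr
      _ = _ := by rw [mul_pow, sq_abs]
  · have h3 := h1 i j hj
    rw [unit_apply_ne hj, sub_zero]
    simp only [t, hj, if_false, zero_add]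
    rw [norm_smul, Complex.norm_real, Real.norm_of_nonneg (by positivity)]
    calc (|P.b j| ^ ρ / |P.b k| ^ ρ * ‖P.rieszVector ν k i j‖) ^ 2
        ≤ (|P.b j| ^ ρ / |P.b k| ^ ρ * (K * (|P.b j| / |P.ω j - P.ω k|))) ^ 2 := by gcongr
      _ = _ := by
        have e1 : ∀ l, |P.b l| ^ (2 * ρ) = (|P.b l| ^ ρ) ^ 2 := fun l => by
          rw [mul_comm, Real.rpow_mul (abs_nonneg _), Real.rpow_two]
        have e2 : |P.b j| ^ (2 * (1 + ρ)) = |P.b j| ^ 2 * (|P.b j| ^ ρ) ^ 2 := by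
          rw [mul_add, Real.rpow_add (hpos j), e1, mul_one, Real.rpow_two]
        rw [e1, e2, ← sq_abs (P.ω j - P.ω k)]
        ring

-- Both alternatives are needed: injectivity for ρ = 0, dense range for the given ρ.
open StateSpace in
theorem IsLabelling.exists_weighted_synthesis (hν : P.IsLabelling ν) (hA5 : P.A5 ρ)
    {D : StateSpace →L[ℂ] StateSpace} (hD : ∀ a k, D a k = ((|P.b k| ^ ρ : ℝ) : ℂ) • a k) :
    ∃ T : StateSpace →L[ℂ] StateSpace,
      (∀ a, HasSum (fun x : ℕ × Fin 4 =>
        coord x a • ((|P.b x.1| ^ (-ρ) : ℝ) : ℂ) • D (P.rieszVector ν x.1 x.2)) (T a)) ∧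
      (Function.Injective T ∨ DenseRange T → Function.Bijective T) :=
  exists_synthesis_of_summable_sq_sub coord hasSum_norm_coord_sq unit hasSum_coord_smul_unit _
    (hν.summable_norm_sub_unit_sq hA5 hD)

/-- A bijective bounded operator as a continuous linear equivalence. -/
theorem exists_equiv_of_bijective {E : Type*} [NormedAddCommGroup E] [NormedSpace ℂ E]
    [CompleteSpace E] {T : E →L[ℂ] E} (h : Function.Bijective T) :
    ∃ e : E ≃L[ℂ] E, ∀ x, e x = T x :=
  ⟨ContinuousLinearEquiv.ofBijective T (LinearMap.ker_eq_bot.2 h.1) (LinearMap.range_eq_top.2 h.2),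
    fun _ => rfl⟩

/-- The Riesz vectors form a Riesz basis of the state space. -/
theorem IsLabelling.exists_isSynthesis (hν : P.IsLabelling ν) (hA4 : P.A4) :
    ∃ π₀ : StateSpace ≃L[ℂ] StateSpace, P.IsSynthesis ν π₀ := by
  obtain ⟨T, hT, hbij⟩ := hν.exists_weighted_synthesis (P.a5_zero_of_a4 hA4)
    (D := ContinuousLinearMap.id ℂ StateSpace) (fun a k => by simp)
  have hT' : ∀ a : StateSpace, HasSum
      (fun x : ℕ × Fin 4 => a x.1 x.2 • P.rieszVector ν x.1 x.2) (T a) := fun a => by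
    simpa [StateSpace.coord_apply] using hT a
  have hinj : Function.Injective T := (injective_iff_map_eq_zero T).2 fun a ha =>
    hν.eq_zero_of_hasSum_rieszVector hA4 (by rw [← ha]; exact hT' a)
  obtain ⟨e, he⟩ := exists_equiv_of_bijective (hbij (Or.inl hinj))
  exact ⟨e, fun a => by rw [he]; exact hT' a⟩

open StateSpace in
/-- The synthesis operator is similar to a bounded bijection via the diagonal operator. -/
theorem IsLabelling.exists_equiv_diagonal (hν : P.IsLabelling ν) (hA5 : P.A5 ρ)
    {D : StateSpace →L[ℂ] StateSpace} (hD : ∀ a k, D a k = ((|P.b k| ^ ρ : ℝ) : ℂ) • a k)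
    {π₀ : StateSpace ≃L[ℂ] StateSpace} (hπ : P.IsSynthesis ν π₀) :
    ∃ S : StateSpace ≃L[ℂ] StateSpace, ∀ a, S (D a) = D (π₀ a) := by
  obtain ⟨T, hT, hbij⟩ := hν.exists_weighted_synthesis hA5 hD
  have hrp : ∀ l, |P.b l| ^ ρ ≠ 0 := fun l =>
    (Real.rpow_pos_of_pos (abs_pos.2 (P.b_ne_zero l)) _).ne'
  have hTD : ∀ a, T (D a) = D (π₀ a) := by
    intro a
    refine (hT (D a)).unique ?_
    convert! (hπ a).mapL D using 2 with x
    rw [map_smul, smul_smul, coord_apply, hD, PiLp.smul_apply, smul_eq_mul,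
      Real.rpow_neg (abs_nonneg _), mul_right_comm, ← Complex.ofReal_mul,
      mul_inv_cancel₀ (hrp _), Complex.ofReal_one, one_mul]
  have hDunit : ∀ n, ((|P.b n.1| ^ (-ρ) : ℝ) : ℂ) • D (unit n) = unit n := by
    rintro ⟨k, i⟩
    ext j : 2
    rw [lp.coeFn_smul, Pi.smul_apply, hD]
    by_cases hj : j = k
    · subst hj
      rw [smul_smul, Real.rpow_neg (abs_nonneg _), ← Complex.ofReal_mul,
        inv_mul_cancel₀ (hrp _), Complex.ofReal_one, one_smul]
    · rw [unit_apply_ne hj, smul_zero, smul_zero]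
  -- The range of `D` contains all finitely supported sequences.
  have hDdense : DenseRange D := by
    intro a
    refine mem_closure_of_tendsto (hasSum_coord_smul_unit a) (Eventually.of_forall fun s => ?_)
    refine ⟨∑ n ∈ s, coord n a • ((|P.b n.1| ^ (-ρ) : ℝ) : ℂ) • unit n, ?_⟩
    simp only [map_sum, map_smul, hDunit]
  -- From `D = T D π₀⁻¹`, the range of `T` contains that of `D`. This makes a second independence
  -- proof, for weighted coefficients, unnecessary.
  have hdense : DenseRange T := by
    refine hDdense.mono ?_
    rintro _ ⟨a, rfl⟩
    exact ⟨D (π₀.symm a), by rw [hTD, ContinuousLinearEquiv.apply_symm_apply]⟩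
  obtain ⟨e, he⟩ := exists_equiv_of_bijective (hbij (Or.inr hdense))
  exact ⟨e, fun a => by rw [he, hTD]⟩

/-! ### Transfer to the weighted space -/

theorem WeightedSpace.W_surjective {γ : ℝ} :
    Function.Surjective (WeightedSpace.W : P.WeightedSpace γ →ₗ[ℂ] StateSpace) := by
  intro x
  have hk : ∀ k, ((|P.b k| ^ (-γ) : ℝ) : ℂ) • (((|P.b k| ^ (-γ) : ℝ) : ℂ)⁻¹ • x k) = x k :=
    fun k => smul_inv_smul₀ (by
      exact_mod_cast (Real.rpow_pos_of_pos (abs_pos.2 (P.b_ne_zero k)) _).ne') _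
  have hmem : (fun k => ((|P.b k| ^ (-γ) : ℝ) : ℂ)⁻¹ • x k) ∈ P.weightedSubmodule γ := by
    change Memℓp _ 2
    simp only [hk]
    exact lp.memℓp x
  refine ⟨⟨_, hmem⟩, ?_⟩
  ext k : 2
  exact hk k

/-- The diagonal map `W_γ` as an isometric isomorphism. -/
noncomputable def WeightedSpace.equiv (P : Oscillator) (γ : ℝ) :
    P.WeightedSpace γ ≃ₗᵢ[ℂ] StateSpace :=
  LinearIsometryEquiv.ofSurjective ⟨WeightedSpace.W, fun _ => rfl⟩ WeightedSpace.W_surjective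

end Oscillator

theorem mainTheorem4 (P : Oscillator) (hA4 : P.A4) (ρ : ℝ) (hρ : 0 < ρ) (hA5 : P.A5 ρ)
    (ν : ℕ → ℂ) (hν : P.IsLabelling ν) :
    ∃ π₀ : StateSpace ≃L[ℂ] StateSpace, P.IsSynthesis ν π₀ ∧
      ∃ T : P.WeightedSpace (-ρ) ≃L[ℂ] P.WeightedSpace (-ρ),
        ∀ a : StateSpace, ∃ v : P.WeightedSpace (-ρ),
          v.val = (a : ℕ → EuclideanSpace ℂ (Fin 4)) ∧
          (T v).val = (π₀ a : ℕ → EuclideanSpace ℂ (Fin 4)) := by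
  obtain ⟨π₀, hπ⟩ := hν.exists_isSynthesis hA4
  obtain ⟨D, hD⟩ := P.exists_diagonal hρ.le
  obtain ⟨S, hS⟩ := hν.exists_equiv_diagonal hA5 hD hπ
  have hmem : ∀ a : StateSpace,
      (a : ℕ → EuclideanSpace ℂ (Fin 4)) ∈ P.weightedSubmodule (-ρ) := by
    intro a
    change Memℓp _ 2
    simp only [neg_neg, ← hD]
    exact lp.memℓp (D a)
  let ι : StateSpace → P.WeightedSpace (-ρ) := fun a => ⟨a, hmem a⟩
  let E := (Oscillator.WeightedSpace.equiv P (-ρ)).toContinuousLinearEquiv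
  have hE : ∀ a, E (ι a) = D a := by
    intro a
    ext k : 2
    rw [hD]
    change ((|P.b k| ^ (-(-ρ)) : ℝ) : ℂ) • a k = _
    rw [neg_neg]
  -- On the image of X the isometry `E` acts as `D`, so `S D = D π₀` says that `E⁻¹ S E` restricts
  -- to `π₀`.
  refine ⟨π₀, hπ, (E.trans S).trans E.symm, fun a => ⟨ι a, rfl, ?_⟩⟩
  have h : ((E.trans S).trans E.symm) (ι a) = ι (π₀ a) := by
    rw [ContinuousLinearEquiv.trans_apply, ContinuousLinearEquiv.trans_apply,
      ContinuousLinearEquiv.symm_apply_eq, hE, hE, hS]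
  rw [h]
  rfl
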